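/- A signed graph $G_\sigma$ is a finite multigraph $G$ (loops and parallel edges allowed) with a sign $\sigma(e)\in\{+,-\}$ for each edge $e$. A cycle is (the edge set of) a simple closed path of $G$; a loop is a cycle of length $1$ and a pair of parallel links is a cycle of length $2$. A cycle is balanced if it has an even number of negative edges, and a signed graph is balanced if all its cycles are. A bowtie of $G_\sigma$ is the union of two distinct unbalanced cycles which meet at a single vertex, or the union of two vertex-disjoint unbalanced cycles and a simple path which meets one cycle at each end and is otherwise disjoint from them. A cocycle of $G$ is a minimal set of edges whose removal increases the number of connected components of $G$. A cocircuit of $G_\sigma$ is a minimal set of edges whose removal increases the number of balanced connected components of $G_\sigma$ if $G_\sigma$ is unbalanced, and the number of connected components if $G_\sigma$ is balanced. Sets $C_1,\ldots,C_r$ are non-redundant if $\bigcup_{i\neq j}C_i\subsetneq\bigcup_{i=1}^r C_i$ for $j=1,\ldots,r$. The incidence matrix of $G_\sigma$ over a field $K$ has rows indexed by the vertices and columns indexed by the edges. The column of a link with ends $t_i,t_j$ is $\mathbf{e}_i-\mathbf{e}_j$ (with either choice of the order of the ends) if the link is positive and $\mathbf{e}_i+\mathbf{e}_j$ if it is negative;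 the column of a loop at $t_i$ is $\mathbf{0}$ if the loop is positive and $2\mathbf{e}_i$ if it is negative. For a linear code $C\subseteq K^m$, $C^\perp$ is its dual code and, for $1\le r\le\dim_K C$, the $r$-th generalized Hamming weight $\delta_r(C)$ is the minimum of $|\chi(D)|$ over the $r$-dimensional subspaces $D$ of $C$, where $\chi(D)$ is the set of positions at which some element of $D$ is nonzero. **Theorem.** Let $G_\sigma$ be a connected signed graph with $s$ vertices and $m$ edges, and let $C$ be the linear code generated by the rows of the incidence matrix of $G_\sigma$ over a finite field $K$ of characteristic $p$. (a) If $p=2$ or $G_\sigma$ is balanced, and $1\le r\le m-s+1$ (resp. $1\le r\le s-1$), then $\delta_r(C^\perp)$ (resp. $\delta_r(C)$) is defined and is the minimum number of edges in a union of $r$ non-redundant cycles (resp. cocycles) of $G$. (b) If $p\neq 2$ and $1\le r\le m-s$ (resp. $1\le r\le s$, with $r\neq s$ if $G_\sigma$ is balanced), then $\delta_r(C^\perp)$ (resp. $\delta_r(C)$) is defined and is the minimum number of edges in a union of $r$ non-redundant circuits, that is, balanced cycles and bowties (resp. cocircuits), of $G_\sigma$. -/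

import Mathlib

/-! Multigraphs are Mathlib's `Graph α β` (loops and parallel edges allowed). A signed graph is a
multigraph `G` with a map `σ : β → ℤˣ`, of which only the values on the edges of `G` matter. -/

namespace Graph

variable {α β : Type*}

/-! ### Connectedness -/

/-- `G` is connected: it has a vertex, and any two vertices are joined by a walk. -/
def IsConnected (G : Graph α β) : Prop :=
  G.vertexSet.Nonempty ∧
    ∀ x ∈ G.vertexSet, ∀ y ∈ G.vertexSet, Relation.ReflTransGen G.Adj x y

/-- The vertex sets of the connected components of `G`. -/
def components (G : Graph α β) : Set (Set α) :=
  {S | ∃ x ∈ G.vertexSet, S = {y | Relation.ReflTransGen G.Adj x y}}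

/-- The number of connected components of `G`. -/
noncomputable def numComponents (G : Graph α β) : ℕ := G.components.ncard

/-! ### Cycles and paths -/

/-- `W` and `X` are the vertex set and the edge set of a cycle
`v 0, e 0, v 1, e 1, …, v n, e n, v 0` of length `n + 1` (the addition in `Fin (n + 1)` is cyclic).
A loop is a cycle of length one and a pair of parallel links is a cycle of length two. -/
def IsCycleWith (G : Graph α β) (W : Set α) (X : Set β) : Prop :=
  ∃ (n : ℕ) (v : Fin (n + 1) → α) (e : Fin (n + 1) → β),
    Function.Injective v ∧ Function.Injective e ∧
    (∀ i, G.IsLink (e i) (v i) (v (i + 1))) ∧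
    W = Set.range v ∧ X = Set.range e

/-- `X` is the edge set of a cycle of `G`. -/
def IsCycle (G : Graph α β) (X : Set β) : Prop :=
  ∃ W : Set α, G.IsCycleWith W X

/-- `W` and `X` are the vertex set and the edge set of a simple path of `G` from `x` to `y`. -/
def IsPathWith (G : Graph α β) (x y : α) (W : Set α) (X : Set β) : Prop :=
  ∃ (n : ℕ) (v : Fin (n + 1) → α) (e : Fin n → β),
    Function.Injective v ∧
    (∀ i : Fin n, G.IsLink (e i) (v i.castSucc) (v i.succ)) ∧
    v 0 = x ∧ v (Fin.last n) = y ∧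
    W = Set.range v ∧ X = Set.range e

/-! ### Balance -/

/-- The set `X` contains an even number of negative edges. -/
def IsBalancedSet (σ : β → ℤˣ) (X : Set β) : Prop :=
  Even {e ∈ X | σ e = -1}.ncard

/-- The signed graph `(G, σ)` is balanced: every cycle is balanced. -/
def IsBalanced (G : Graph α β) (σ : β → ℤˣ) : Prop :=
  ∀ X : Set β, G.IsCycle X → IsBalancedSet σ X

/-- The number of balanced connected components of `(G, σ)`. -/
noncomputable def numBalancedComponents (G : Graph α β) (σ : β → ℤˣ) : ℕ :=
  {S ∈ G.components | (G.induce S).IsBalanced σ}.ncard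

/-- `X` is the edge set of a balanced cycle of `(G, σ)`. -/
def IsBalancedCycle (G : Graph α β) (σ : β → ℤˣ) (X : Set β) : Prop :=
  G.IsCycle X ∧ IsBalancedSet σ X

/-- `X` is the edge set of a bowtie of `(G, σ)`: the union of two unbalanced cycles whose
intersection is a single vertex, or the union of two vertex-disjoint unbalanced cycles and a
simple path that meets one cycle at each end and is otherwise disjoint from them.
In the first case the edge sets have to be disjoint because a loop also meets itself in a single
vertex. -/
def IsBowtie (G : Graph α β) (σ : β → ℤˣ) (X : Set β) : Prop :=
  ∃ (W₁ W₂ : Set α) (C₁ C₂ : Set β),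
    G.IsCycleWith W₁ C₁ ∧ ¬ IsBalancedSet σ C₁ ∧
    G.IsCycleWith W₂ C₂ ∧ ¬ IsBalancedSet σ C₂ ∧
    (((∃ x, W₁ ∩ W₂ = {x}) ∧ Disjoint C₁ C₂ ∧ X = C₁ ∪ C₂) ∨
      (Disjoint W₁ W₂ ∧ ∃ (x y : α) (W : Set α) (P : Set β), G.IsPathWith x y W P ∧
        W ∩ W₁ = {x} ∧ W ∩ W₂ = {y} ∧ X = C₁ ∪ C₂ ∪ P))

/-- The circuits of `(G, σ)`: balanced cycles and bowties. -/
def IsSignedCircuit (G : Graph α β) (σ : β → ℤˣ) (X : Set β) : Prop :=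
  G.IsBalancedCycle σ X ∨ G.IsBowtie σ X

/-! ### Cocycles and cocircuits -/

/-- Removing the edge set `X` increases the number of connected components of `G`. -/
def IsEdgeCut (G : Graph α β) (X : Set β) : Prop :=
  X ⊆ G.edgeSet ∧ G.numComponents < (G.deleteEdges X).numComponents

/-- Cocycles (bonds) of the multigraph `G`. -/
def IsCocycle (G : Graph α β) (X : Set β) : Prop :=
  Minimal G.IsEdgeCut X

/-- Cutsets of `(G, σ)`: edge sets whose removal increases the number of connected components if
`(G, σ)` is balanced, and the number of balanced connected components if it is unbalanced. -/
def IsSignedCutset (G : Graph α β) (σ : β → ℤˣ) (X : Set β) : Prop :=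
  X ⊆ G.edgeSet ∧
    (G.IsBalanced σ → G.numComponents < (G.deleteEdges X).numComponents) ∧
    (¬ G.IsBalanced σ →
      G.numBalancedComponents σ < (G.deleteEdges X).numBalancedComponents σ)

/-- Cocircuits of `(G, σ)`: minimal cutsets. -/
def IsSignedCocircuit (G : Graph α β) (σ : β → ℤˣ) (X : Set β) : Prop :=
  Minimal (G.IsSignedCutset σ) X

/-! ### Incidence matrices -/

open Classical in
/-- `A` is an incidence matrix of `(G, σ)`: the column of an edge `e` with ends `x` and `y` is
`e_x - σ(e) e_y`. So the column is `±(e_x - e_y)` for a positive link (either choice of the sign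
is admitted), `e_x + e_y` for a negative link, `0` for a positive loop, and `2 e_x` for a negative
loop. -/
def IsIncidenceMatrix {K : Type*} [Field K] (G : Graph α β) (σ : β → ℤˣ)
    (A : Matrix G.vertexSet G.edgeSet K) : Prop :=
  ∀ e : G.edgeSet, ∃ x y : G.vertexSet, G.IsLink e x y ∧
    A.col e = Pi.single x 1 - ((σ e : ℤ) : K) • Pi.single y 1

end Graph

/-! ### Linear codes -/

section Codes

variable {K ι κ : Type*} [Field K]

/-- The linear code generated by the rows of a matrix. -/
def rowCode (A : Matrix κ ι K) : Submodule K (ι → K) :=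
  Submodule.span K (Set.range A.row)

/-- The dual code `C^⊥`. -/
def dualCode [Fintype ι] (C : Submodule K (ι → K)) : Submodule K (ι → K) where
  carrier := {x | ∀ c ∈ C, c ⬝ᵥ x = 0}
  add_mem' hx hy c hc := by rw [dotProduct_add, hx c hc, hy c hc, add_zero]
  zero_mem' c _ := dotProduct_zero c
  smul_mem' a x hx c hc := by rw [dotProduct_smul, hx c hc, smul_zero]

/-- The support of a linear code: the set of its nonzero positions. -/
def codeSupport (D : Submodule K (ι → K)) : Set ι :=
  {i | ∃ a ∈ D, a i ≠ 0}

/-- `d` is the `r`-th generalized Hamming weight of `C`, that is, the minimum of the support sizes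
of the `r`-dimensional subspaces of `C`. -/
def IsGenHammingWeight (C : Submodule K (ι → K)) (r d : ℕ) : Prop :=
  IsLeast {n | ∃ D : Submodule K (ι → K),
    D ≤ C ∧ Module.finrank K D = r ∧ (codeSupport D).ncard = n} d

end Codes

/-! ### Non-redundant unions -/

/-- No member of the family can be left out without making the union smaller. -/
def IsNonRedundant {β : Type*} {r : ℕ} (F : Fin r → Set β) : Prop :=
  ∀ j, (⋃ (i : Fin r) (_ : i ≠ j), F i) ⊂ ⋃ i, F i

/-- The sizes of the unions of `r` non-redundant sets that satisfy `P`. -/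
def nonRedundantUnionSizes {β : Type*} (P : Set β → Prop) (r : ℕ) : Set ℕ :=
  {n | ∃ F : Fin r → Set β, (∀ i, P (F i)) ∧ IsNonRedundant F ∧ (⋃ i, F i).ncard = n}

/-! Generalized Hamming weights depend only on minimal supports. Suppose every member of a family of
edge sets is the support of a nonzero word, and every nonzero word has a member inside its support.
Words with non-redundant supports are independent, as each has a private position. Conversely, an
`r`-dimensional subspace contains `r` words in echelon form, and each can be replaced by a word of
minimal support inside its own that keeps the pivot. This gives
`exists_isGenHammingWeight_and_isLeast`; it remains to find suitable families.

Call a vertex function `x` a potential on a set of edges if `x a = σ(e) x b` for each of its edges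
`e` with ends `a`, `b`. The combination of the rows with coefficients `x` vanishes at `e` exactly
when `x` is a potential on `e`.

Dual code: suitably scaled columns telescope along a path, and closing a cycle leaves `1 - sign`
times a unit vector. This is zero for balanced cycles and in characteristic 2; otherwise two
unbalanced cycles cancel each other through a bowtie. Conversely, a dual word forces any potential
on all but one edge of its support to extend to that edge (`potential_apply_eq`), which yields a
cycle, respectively a signed circuit, in the support.

Row code: a nonzero word supported in `X` is a potential off `X` that is not a potential on all of
`G`. Outside characteristic 2, nowhere-zero potentials on a component exist exactly if it is
balanced, so the sets containing such supports are the cutsets, and the minimal ones are the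
cocircuits. If `G` has a nowhere-zero potential, dividing by it leaves the question of
connectedness, hence cocycles. The dimensions follow because the global potentials form a space of
dimension 1 or 0. -/

/-! ### Generalized Hamming weights and supports -/

section Codes

variable {K ι : Type*} [Field K]

/-- A space of dimension at least `r` has `r` elements in reduced echelon form. -/
theorem Submodule.exists_echelon [Finite ι] (r : ℕ) (D : Submodule K (ι → K))
    (hr : r ≤ Module.finrank K D) :
    ∃ (e : Fin r → ι) (c : Fin r → ι → K), (∀ i, c i ∈ D) ∧
      ∀ i j, c i (e j) = if i = j then 1 else 0 := by
  have := Fintype.ofFinite ι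
  induction r generalizing D with
  | zero => exact ⟨Fin.elim0, Fin.elim0, fun i => i.elim0, fun i => i.elim0⟩
  | succ r ih =>
    have hD : D ≠ ⊥ := by
      rintro rfl
      simp at hr
    obtain ⟨w, hw, hw0⟩ := D.exists_mem_ne_zero_of_ne_bot hD
    obtain ⟨a, ha⟩ := Function.ne_iff.1 hw0
    let f : D →ₗ[K] K := (LinearMap.proj a).comp D.subtype
    -- Requiring a zero at the new pivot `a` costs at most one dimension.
    have hker : r ≤ Module.finrank K (f.ker.map D.subtype) := by
      rw [LinearEquiv.finrank_eq (Submodule.equivMapOfInjective D.subtype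
        D.injective_subtype f.ker).symm]
      have h1 := f.finrank_range_add_finrank_ker
      have h2 : Module.finrank K f.range ≤ 1 :=
        (Submodule.finrank_le _).trans (by simp)
      omega
    obtain ⟨e, c, hc, hce⟩ := ih _ hker
    have hc' : ∀ i, c i ∈ D ∧ c i a = 0 := by
      intro i
      obtain ⟨x, hx, hxc⟩ := hc i
      rw [← hxc]
      exact ⟨x.2, hx⟩
    let u : ι → K := (w a)⁻¹ • w
    have hu : u ∈ D := D.smul_mem _ hw
    have hua : u a = 1 := by simpa [u] using inv_mul_cancel₀ ha
    -- The old words vanish at `a`; subtracting them from `u` clears `u` at the old pivots without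
    -- changing its value at `a`.
    refine ⟨Fin.cons a e, Fin.cons (u - ∑ j, u (e j) • c j) c, ?_, ?_⟩
    · intro i
      refine Fin.cases ?_ (fun i => ?_) i
      · exact D.sub_mem hu (D.sum_mem fun j _ => D.smul_mem _ (hc' j).1)
      · exact (hc' i).1
    · intro i j
      refine Fin.cases ?_ (fun i => ?_) i <;> refine Fin.cases ?_ (fun j => ?_) j
      · simp [hua, (hc' _).2]
      · simp [hce, (Fin.succ_ne_zero _).symm]
      · simp [(hc' _).2]
      · simp [hce]

/-- Every position of the support of a word lies in the support of a word of minimal support. -/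
theorem Submodule.exists_minimal_support [Finite ι] (C : Submodule K (ι → K)) {c : ι → K}
    (hc : c ∈ C) {a : ι} (ha : c a ≠ 0) :
    ∃ w ∈ C, w a ≠ 0 ∧ Function.support w ⊆ Function.support c ∧
      ∀ w' ∈ C, w' ≠ 0 → Function.support w' ⊆ Function.support w →
        Function.support w' = Function.support w := by
  obtain ⟨X, hX⟩ := (Set.toFinite {X : Set ι | ∃ w ∈ C, w a ≠ 0 ∧
    Function.support w ⊆ Function.support c ∧ Function.support w = X}).exists_minimal
      ⟨_, c, hc, ha, subset_rfl, rfl⟩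
  obtain ⟨⟨w, hw, hwa, hwc, rfl⟩, hmin⟩ := hX
  refine ⟨w, hw, hwa, hwc, fun w' hw' hw'0 hsub => ?_⟩
  -- `w` is minimal only among words nonzero at `a`. If `w'` vanishes there, subtracting a multiple
  -- of `w'` kills a position `b` of `w` but keeps `a`, against minimality.
  by_cases hw'a : w' a = 0
  · exfalso
    obtain ⟨b, hb⟩ := Function.ne_iff.1 hw'0
    have hwb : w b ≠ 0 := hsub hb
    have hsup : Function.support (w - (w b / w' b) • w') ⊆ Function.support w := by
      intro i hi hwi
      have : w' i = 0 := by
        by_contra h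
        exact hsub h hwi
      exact hi (by simp [hwi, this])
    have := hmin ⟨w - (w b / w' b) • w', C.sub_mem hw (C.smul_mem _ hw'), by simpa [hw'a] using hwa,
      hsup.trans hwc, rfl⟩ hsup hwb
    refine this ?_
    simp only [Pi.sub_apply, Pi.smul_apply, smul_eq_mul]
    rw [div_mul_cancel₀ _ hb, sub_self]
  · exact hsub.antisymm (hmin ⟨w', hw', hw'a, hsub.trans hwc, rfl⟩ hsub)

/-- If the sets satisfying `P` are supports of words of `C` and every support of a nonzero word
contains one of them, the generalized Hamming weights of `C` are the minimum sizes of unions of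
non-redundant sets satisfying `P`. -/
theorem exists_isGenHammingWeight_and_isLeast {β : Type*} {E : Set β} [Finite E]
    (C : Submodule K (E → K)) (P : Set β → Prop)
    (hP : ∀ X, P X → ∃ w ∈ C, w ≠ 0 ∧ Subtype.val '' Function.support w = X)
    (hC : ∀ w ∈ C, w ≠ 0 → ∃ X, P X ∧ X ⊆ Subtype.val '' Function.support w)
    (r : ℕ) (hr : r ≤ Module.finrank K C) :
    ∃ d, IsGenHammingWeight C r d ∧ IsLeast (nonRedundantUnionSizes P r) d := by
  have := Fintype.ofFinite E
  set S : Set ℕ := {n | ∃ D : Submodule K (E → K),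
    D ≤ C ∧ Module.finrank K D = r ∧ (codeSupport D).ncard = n} with hS
  set T := nonRedundantUnionSizes P r with hT
  -- Private positions make the chosen words independent, and their span is supported in the union.
  have hTS : ∀ n ∈ T, ∃ k ∈ S, k ≤ n := by
    rintro n ⟨F, hF, hnr, rfl⟩
    choose w hw _ hwF using fun i => hP _ (hF i)
    have hpriv : ∀ j, ∃ a : E, w j a ≠ 0 ∧ ∀ i, i ≠ j → w i a = 0 := by
      intro j
      obtain ⟨b, hb, hb'⟩ := Set.exists_of_ssubset (hnr j)
      obtain ⟨i, hi⟩ := Set.mem_iUnion.1 hb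
      simp only [Set.mem_iUnion, not_exists] at hb'
      have hij : i = j := by
        by_contra h
        exact hb' i h hi
      subst hij
      rw [← hwF i] at hi
      obtain ⟨a, ha, rfl⟩ := hi
      refine ⟨a, ha, fun k hk => ?_⟩
      by_contra h
      refine hb' k hk ?_
      rw [← hwF k]
      exact ⟨a, h, rfl⟩
    have hli : LinearIndependent K w := by
      rw [Fintype.linearIndependent_iff]
      intro g hg j
      obtain ⟨a, ha, ha'⟩ := hpriv j
      have := congrFun hg a
      rw [Finset.sum_apply, Finset.sum_eq_single j] at this
      · simpa [ha] using this
      · intro i _ hi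
        simp [ha' i hi]
      · simp
    refine ⟨_, ⟨Submodule.span K (Set.range w), Submodule.span_le.2 ?_, ?_, rfl⟩, ?_⟩
    · rintro _ ⟨i, rfl⟩
      exact hw i
    · rw [finrank_span_eq_card hli, Fintype.card_fin]
    · rw [← Set.ncard_image_of_injective _ (Subtype.val_injective (p := (· ∈ E)))]
      have hfin : (⋃ i, F i).Finite := by
        refine Set.finite_iUnion fun i => ?_
        rw [← hwF i]
        exact Set.toFinite _
      refine Set.ncard_le_ncard ?_ hfin
      rintro _ ⟨a, ⟨c, hc, hca⟩, rfl⟩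
      by_contra hcon
      refine hca ?_
      have hle : Submodule.span K (Set.range w) ≤
          LinearMap.ker (LinearMap.proj a : (E → K) →ₗ[K] K) := by
        rw [Submodule.span_le]
        rintro _ ⟨i, rfl⟩
        by_contra h
        refine hcon (Set.mem_iUnion.2 ⟨i, ?_⟩)
        rw [← hwF i]
        exact ⟨a, h, rfl⟩
      exact hle hc
  -- The bound `r ≤ dim D`, rather than equality, allows `D = C` below, which shows that `T` is
  -- nonempty.
  have hST : ∀ D ≤ C, r ≤ Module.finrank K D → ∃ k ∈ T, k ≤ (codeSupport D).ncard := by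
    intro D hD hDr
    obtain ⟨e, c, hc, hce⟩ := D.exists_echelon r hDr
    choose w hw hwe hwc hwmin using fun i =>
      C.exists_minimal_support (hD (hc i)) (a := e i) (by simp [hce])
    -- The support of `w i` contains a set satisfying `P`, itself the support of a word of `C`;
    -- minimality makes the two equal.
    have hPw : ∀ i, P (Subtype.val '' Function.support (w i)) := by
      intro i
      obtain ⟨X, hX, hXw⟩ := hC (w i) (hw i) (fun h => hwe i (by simp [h]))
      obtain ⟨w', hw', h0, rfl⟩ := hP X hX
      rwa [← hwmin i w' hw' h0 ((Set.image_subset_image_iff Subtype.val_injective).1 hXw)]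
    refine ⟨_, ⟨fun i => Subtype.val '' Function.support (w i), hPw, ?_, rfl⟩, ?_⟩
    · intro j
      rw [Set.ssubset_iff_of_subset (Set.iUnion₂_subset fun i _ =>
        Set.subset_iUnion (fun i => Subtype.val '' Function.support (w i)) i)]
      -- The pivot `e j` is private: the other echelon words vanish there, and shrinking supports
      -- preserves this.
      refine ⟨e j, Set.mem_iUnion.2 ⟨j, e j, hwe j, rfl⟩, ?_⟩
      simp only [Set.mem_iUnion, not_exists]
      rintro i hij ⟨a, ha, hae⟩
      obtain rfl := Subtype.val_injective hae
      exact hwc i ha (by simp [hce, hij])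
    · rw [← Set.image_iUnion, Set.ncard_image_of_injective _ Subtype.val_injective]
      refine Set.ncard_le_ncard (Set.iUnion_subset fun i a ha => ?_) (Set.toFinite _)
      exact ⟨c i, hc i, hwc i ha⟩
  obtain ⟨n, hn, -⟩ := hST C le_rfl hr
  have hTleast : IsLeast T (sInf T) := ⟨Nat.sInf_mem ⟨n, hn⟩, fun _ h => Nat.sInf_le h⟩
  have hlow : ∀ k ∈ S, sInf T ≤ k := by
    rintro k ⟨D, hD, hDr, rfl⟩
    obtain ⟨l, hl, hlk⟩ := hST D hD hDr.ge
    exact (Nat.sInf_le hl).trans hlk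
  obtain ⟨k, hk, hkT⟩ := hTS _ hTleast.1
  exact ⟨sInf T, ⟨le_antisymm hkT (hlow k hk) ▸ hk, hlow⟩, hTleast⟩

end Codes

namespace Graph

variable {α β : Type*} {G : Graph α β} {σ : β → ℤˣ}

/-! ### Simple paths with signs -/

/-- `G.SignedPath σ x y W X ε`: there is a simple path from `x` to `y` with vertex set `W`, edge
set `X` and product of the edge signs `ε`. -/
inductive SignedPath (G : Graph α β) (σ : β → ℤˣ) : α → α → Set α → Set β → ℤˣ → Prop
  | nil {x : α} (hx : x ∈ G.vertexSet) : SignedPath G σ x x {x} ∅ 1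
  | cons {x y z : α} {e : β} {W : Set α} {X : Set β} {ε : ℤˣ} (he : G.IsLink e x y)
      (h : SignedPath G σ y z W X ε) (hx : x ∉ W) :
      SignedPath G σ x z (insert x W) (insert e X) (σ e * ε)

namespace SignedPath

variable {x y z : α} {W W' T : Set α} {X X' : Set β} {ε ε' : ℤˣ}

theorem left_mem (h : G.SignedPath σ x y W X ε) : x ∈ W := by
  cases h <;> simp

theorem right_mem (h : G.SignedPath σ x y W X ε) : y ∈ W := by
  induction h with
  | nil => simp
  | cons _ _ _ ih => exact Or.inr ih

theorem ends_mem (h : G.SignedPath σ x y W X ε) {e : β} (he : e ∈ X) {a b : α}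
    (hab : G.IsLink e a b) : a ∈ W ∧ b ∈ W ∧ a ≠ b := by
  induction h with
  | nil => simp at he
  | cons hl h hx ih =>
    rcases he with rfl | he
    · rcases hab.eq_and_eq_or_eq_and_eq hl with ⟨rfl, rfl⟩ | ⟨rfl, rfl⟩
      · exact ⟨Or.inl rfl, Or.inr h.left_mem, fun hh => hx (hh ▸ h.left_mem)⟩
      · exact ⟨Or.inr h.left_mem, Or.inl rfl, fun hh => hx (hh ▸ h.left_mem)⟩
    · exact ⟨Or.inr (ih he).1, Or.inr (ih he).2.1, (ih he).2.2⟩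

theorem subset_edgeSet (h : G.SignedPath σ x y W X ε) : X ⊆ G.edgeSet := by
  induction h with
  | nil => simp
  | cons hl _ _ ih => exact Set.insert_subset hl.edge_mem ih

theorem finite_edges (h : G.SignedPath σ x y W X ε) : X.Finite := by
  induction h with
  | nil => simp
  | cons _ _ _ ih => exact ih.insert _

theorem notMem_of_notMem (h : G.SignedPath σ x y W X ε) {e : β} {a b : α}
    (he : G.IsLink e a b) (ha : a ∉ W) : e ∉ X :=
  fun hX => ha (h.ends_mem hX he).1

theorem append (h : G.SignedPath σ x y W X ε) (h' : G.SignedPath σ y z W' X' ε')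
    (hW : W ∩ W' ⊆ {y}) : G.SignedPath σ x z (W ∪ W') (X ∪ X') (ε * ε') := by
  induction h with
  | nil =>
    rwa [Set.empty_union, one_mul, Set.singleton_union, Set.insert_eq_of_mem h'.left_mem]
  | @cons a b c e W X ε hl h hx ih =>
    rw [Set.insert_union, Set.insert_union, mul_assoc]
    refine cons hl (ih h' fun v hv => hW ⟨Or.inr hv.1, hv.2⟩) ?_
    rintro (hv | hv)
    · exact hx hv
    · exact hx ((hW ⟨Or.inl rfl, hv⟩ : a = c) ▸ h.right_mem)

theorem single {e : β} (he : G.IsLink e x y) (hxy : x ≠ y) :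
    G.SignedPath σ x y {x, y} {e} (σ e) := by
  simpa using cons (σ := σ) he (nil he.right_mem) hxy

theorem reverse (h : G.SignedPath σ x y W X ε) : G.SignedPath σ y x W X ε := by
  induction h with
  | nil hx => exact nil hx
  | @cons a b c e W X ε hl h hx ih =>
    have := ih.append (single (σ := σ) hl.symm fun hh => hx (hh ▸ h.left_mem)) (by
      rintro v ⟨hv, rfl | rfl⟩
      · rfl
      · exact absurd hv hx)
    convert this using 1
    · ext v
      have := h.left_mem
      simp only [Set.mem_insert_iff, Set.mem_union, Set.mem_singleton_iff]
      constructor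
      · tauto
      · rintro (h | rfl | h) <;> tauto
    · rw [Set.union_singleton]
    · rw [mul_comm]

/-- A path that meets `T` can be split at its first vertex in `T`. -/
theorem split (h : G.SignedPath σ x y W X ε) (hT : (W ∩ T).Nonempty) :
    ∃ z W₁ W₂ X₁ X₂ ε₁ ε₂, G.SignedPath σ x z W₁ X₁ ε₁ ∧ G.SignedPath σ z y W₂ X₂ ε₂ ∧
      W₁ ∩ T = {z} ∧ W₁ ∩ W₂ = {z} ∧ W = W₁ ∪ W₂ ∧ X = X₁ ∪ X₂ ∧ ε = ε₁ * ε₂ := by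
  induction h with
  | @nil a ha =>
    obtain ⟨_, rfl, hz⟩ := hT
    exact ⟨_, _, _, _, _, _, _, nil ha, nil ha, by simpa using hz, by simp, by simp, by simp,
      by simp⟩
  | @cons a b c e W X ε hl h hx ih =>
    by_cases ha : a ∈ T
    · refine ⟨a, {a}, _, ∅, _, 1, _, nil hl.left_mem, cons hl h hx, by simpa using ha, by simp,
        by simp, by simp, by simp⟩
    · have hT' : (W ∩ T).Nonempty := by
        obtain ⟨v, rfl | hv, hvT⟩ := hT
        · exact absurd hvT ha
        · exact ⟨v, hv, hvT⟩
      obtain ⟨z, W₁, W₂, X₁, X₂, ε₁, ε₂, h₁, h₂, hz, hz', rfl, rfl, rfl⟩ := ih hT'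
      refine ⟨z, _, W₂, _, X₂, _, ε₂, cons hl h₁ fun hh => hx (Or.inl hh), h₂, ?_, ?_, ?_, ?_, ?_⟩
      · rw [Set.insert_inter_of_notMem ha, hz]
      · rw [Set.insert_inter_of_notMem fun hh => hx (Or.inr hh), hz']
      · rw [Set.insert_union]
      · rw [Set.insert_union]
      · rw [mul_assoc]

/-- The sign of a path is the parity of the number of its negative edges. -/
theorem isBalancedSet_insert_iff (h : G.SignedPath σ x y W X ε) {e : β} (he : e ∉ X) :
    IsBalancedSet σ (insert e X) ↔ σ e * ε = 1 := by
  -- Stated for arbitrary edges and sets, since it is used both for the closing edge and for each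
  -- edge of the path.
  have key : ∀ (e : β) (X : Set β), X.Finite → e ∉ X →
      (IsBalancedSet σ (insert e X) ↔ (IsBalancedSet σ X ↔ σ e = 1)) := by
    intro e X hX he
    unfold IsBalancedSet
    rcases Int.units_eq_one_or (σ e) with h1 | h1
    · have : {f | f ∈ insert e X ∧ σ f = -1} = {f | f ∈ X ∧ σ f = -1} := by
        ext f
        simp only [Set.mem_insert_iff, Set.mem_ofPred_eq]
        constructor
        · rintro ⟨rfl | hf, h⟩
          · rw [h1] at h
            exact absurd h (by decide)
          · exact ⟨hf, h⟩
        · exact fun h => ⟨Or.inr h.1, h.2⟩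
      rw [this]
      simp [h1]
    · have : {f | f ∈ insert e X ∧ σ f = -1} = insert e {f | f ∈ X ∧ σ f = -1} := by
        ext f
        simp only [Set.mem_insert_iff, Set.mem_ofPred_eq]
        constructor
        · tauto
        · rintro (rfl | hf)
          · exact ⟨Or.inl rfl, h1⟩
          · exact ⟨Or.inr hf.1, hf.2⟩
      rw [this, Set.ncard_insert_of_notMem (fun hf => he hf.1) (hX.subset fun f hf => hf.1)]
      rw [Nat.even_add_one]
      have h2 : ¬ (-1 : ℤˣ) = 1 := by decide
      simp [h1, h2]
  have key' : ∀ a b : ℤˣ, (b = 1 ↔ a = 1) ↔ a * b = 1 := by decide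
  rw [key e X h.finite_edges he, ← key' (σ e) ε]
  have : IsBalancedSet σ X ↔ ε = 1 := by
    clear he
    induction h with
    | nil => simp [IsBalancedSet]
    | cons hl h hx ih => rw [key _ _ h.finite_edges (h.notMem_of_notMem hl hx), ih, key']
  rw [this]

/-- A function that is multiplied by the sign along each edge is multiplied by the sign along
each path. -/
theorem apply_eq {K : Type*} [Field K] {f : α → K} (h : G.SignedPath σ x y W X ε)
    (hf : ∀ e ∈ X, ∀ a b, G.IsLink e a b → f a = ((σ e : ℤ) : K) * f b) :
    f x = ((ε : ℤ) : K) * f y := by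
  induction h with
  | nil => simp
  | cons hl h hx ih =>
    rw [hf _ (Or.inl rfl) _ _ hl, ih fun e he => hf e (Or.inr he)]
    push_cast
    ring

theorem eq_mul {τ : α → ℤˣ} (h : G.SignedPath σ x y W X ε)
    (hτ : ∀ e ∈ X, ∀ a b, G.IsLink e a b → σ e = τ a * τ b) : ε = τ x * τ y := by
  induction h with
  | nil => simp
  | cons hl h hx ih =>
    rw [hτ _ (Or.inl rfl) _ _ hl, ih fun e he => hτ e (Or.inr he)]
    rw [mul_assoc, ← mul_assoc (τ _) (τ _) (τ _), Int.units_mul_self, one_mul]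

theorem isPathWith (h : G.SignedPath σ x y W X ε) : G.IsPathWith x y W X := by
  induction h with
  | @nil a ha =>
    exact ⟨0, fun _ => a, Fin.elim0, fun i j _ => Fin.ext (by omega), fun i => i.elim0, rfl, rfl,
      by simp, by simp⟩
  | @cons a b c e W X ε hl h hx ih =>
    obtain ⟨n, v, f, hv, hf, h0, hn, rfl, rfl⟩ := ih
    refine ⟨n + 1, Fin.cons a v, Fin.cons e f, Fin.cons_injective_iff.2 ⟨hx, hv⟩, ?_, rfl, ?_, ?_, ?_⟩
    · intro i
      refine Fin.cases ?_ (fun i => ?_) i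
      · simpa [h0] using hl
      · simpa using hf i
    · rw [← Fin.succ_last, Fin.cons_succ, hn]
    · rw [Fin.range_cons]
    · rw [Fin.range_cons]

/-- Equal edges have the same ends. In the same order this forces equal indices; in reverse order it
would force `i = j + 1` and `i + 1 = j`. -/
theorem injective_edges {n : ℕ} {v : Fin (n + 1) → α} {e : Fin n → β} (hv : Function.Injective v)
    (he : ∀ i : Fin n, G.IsLink (e i) (v i.castSucc) (v i.succ)) : Function.Injective e := by
  intro i j hij
  have h := he i
  rw [hij] at h
  rcases h.eq_and_eq_or_eq_and_eq (he j) with ⟨h1, -⟩ | ⟨h1, h2⟩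
  · exact Fin.castSucc_injective n (hv h1)
  · have h1 := congrArg Fin.val (hv h1)
    have h2 := congrArg Fin.val (hv h2)
    simp at h1 h2
    omega

/-- A path and a further edge between its ends form a cycle. -/
theorem isCycleWith (h : G.SignedPath σ y x W X ε) {e : β} (he : G.IsLink e x y) (heX : e ∉ X) :
    G.IsCycleWith W (insert e X) := by
  obtain ⟨n, v, f, hv, hf, rfl, rfl, rfl, rfl⟩ := h.isPathWith
  refine ⟨n, v, Fin.snoc f e, hv, ?_, ?_, rfl, ?_⟩
  · rw [Fin.snoc_injective_iff]
    exact ⟨injective_edges hv hf, heX⟩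
  · intro i
    refine Fin.lastCases ?_ (fun i => ?_) i
    · simpa using he
    · simpa using hf i
  · rw [Fin.range_snoc]

end SignedPath

/-- Passes from indexed sequences to the inductive form, on which the path arguments run. -/
theorem exists_signedPath_of_isLink (σ : β → ℤˣ) {n : ℕ} {v : Fin (n + 1) → α} {e : Fin n → β}
    (hv : Function.Injective v) (h0 : v 0 ∈ G.vertexSet)
    (he : ∀ i : Fin n, G.IsLink (e i) (v i.castSucc) (v i.succ)) :
    ∃ ε, G.SignedPath σ (v 0) (v (Fin.last n)) (Set.range v) (Set.range e) ε := by
  induction n with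
  | zero =>
    refine ⟨1, ?_⟩
    have h1 : Set.range v = {v 0} := by
      ext a
      simp [Fin.exists_fin_one, eq_comm]
    rw [h1, Set.range_eq_empty]
    exact .nil h0
  | succ n ih =>
    obtain ⟨ε, h⟩ := ih (v := Fin.tail v) (e := Fin.tail e)
      (fun i j hij => Fin.succ_injective _ (hv hij)) (he 0).right_mem (fun i => he i.succ)
    have hrv : Set.range v = insert (v 0) (Set.range (Fin.tail v)) := by
      rw [← Fin.range_cons, Fin.cons_self_tail]
    have hre : Set.range e = insert (e 0) (Set.range (Fin.tail e)) := by
      rw [← Fin.range_cons, Fin.cons_self_tail]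
    refine ⟨σ (e 0) * ε, ?_⟩
    rw [hrv, hre]
    refine SignedPath.cons (he 0) h ?_
    rintro ⟨i, hi⟩
    exact Fin.succ_ne_zero i (hv hi)

theorem IsPathWith.exists_signedPath (σ : β → ℤˣ) {x y : α} {W : Set α} {X : Set β}
    (h : G.IsPathWith x y W X) (hx : x ∈ G.vertexSet) : ∃ ε, G.SignedPath σ x y W X ε := by
  obtain ⟨n, v, e, hv, he, rfl, rfl, rfl, rfl⟩ := h
  exact exists_signedPath_of_isLink σ hv hx he

/-- A cycle through `x` consists of an edge at `x` and a path back to `x`. -/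
theorem IsCycleWith.exists_signedPath (σ : β → ℤˣ) {W : Set α} {C : Set β}
    (h : G.IsCycleWith W C) {x : α} (hx : x ∈ W) :
    ∃ e y X ε, G.IsLink e x y ∧ G.SignedPath σ y x W X ε ∧ e ∉ X ∧ C = insert e X := by
  obtain ⟨n, v, e, hv, he, hlink, rfl, rfl⟩ := h
  obtain ⟨k, rfl⟩ := hx
  -- rotate the cycle so that `x` is the last vertex of the path
  let v' : Fin (n + 1) → α := fun i => v (i + (k + 1))
  let e' : Fin (n + 1) → β := fun i => e (i + (k + 1))
  have hv' : Function.Injective v' := fun i j hij => add_right_cancel (hv hij)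
  have he' : Function.Injective e' := fun i j hij => add_right_cancel (he hij)
  have hl : ∀ i, G.IsLink (e' i) (v' i) (v' (i + 1)) := by
    intro i
    have := hlink (i + (k + 1))
    simpa only [v', e', add_right_comm] using this
  have hlast : v' (Fin.last n) = v k := by
    have : Fin.last n + (k + 1) = k := by
      rw [add_comm k 1, ← add_assoc, Fin.last_add_one, zero_add]
    simp only [v', this]
  have hrv : Set.range v' = Set.range v := (Equiv.addRight (k + 1)).surjective.range_comp v
  have hre : Set.range e' = Set.range e := (Equiv.addRight (k + 1)).surjective.range_comp e
  obtain ⟨ε, hε⟩ := exists_signedPath_of_isLink σ (e := Fin.init e') hv' (hl 0).left_mem (by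
    intro i
    have := hl i.castSucc
    rwa [Fin.coeSucc_eq_succ] at this)
  rw [hlast, hrv] at hε
  refine ⟨e' (Fin.last n), v' 0, _, ε, ?_, hε, ?_, ?_⟩
  · have := hl (Fin.last n)
    rwa [Fin.last_add_one, hlast] at this
  · rintro ⟨i, hi⟩
    exact (Fin.castSucc_lt_last i).ne (he' hi)
  · rw [← hre, ← Fin.range_snoc, Fin.snoc_init_self]

theorem IsCycleWith.nonempty {W : Set α} {C : Set β} (h : G.IsCycleWith W C) : W.Nonempty := by
  obtain ⟨n, v, e, _, _, _, rfl, _⟩ := h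
  exact ⟨v 0, 0, rfl⟩

/-- An edge of a cycle, and the path formed by the other edges. -/
theorem IsCycleWith.exists_isLink_and_signedPath (σ : β → ℤˣ) {W : Set α} {C : Set β}
    (h : G.IsCycleWith W C) :
    ∃ e x y X ε, G.IsLink e x y ∧ G.SignedPath σ y x W X ε ∧ e ∉ X ∧ C = insert e X := by
  obtain ⟨x, hx⟩ := h.nonempty
  obtain ⟨e, y, X, ε, h⟩ := h.exists_signedPath σ hx
  exact ⟨e, x, y, X, ε, h⟩

/-- Two vertices of an unbalanced cycle are joined by paths of both signs in the cycle. -/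
theorem IsCycleWith.exists_arc {W : Set α} {C : Set β} (h : G.IsCycleWith W C)
    (hC : ¬ IsBalancedSet σ C) {a b : α} (ha : a ∈ W) (hb : b ∈ W) (hab : a ≠ b) (ε : ℤˣ) :
    ∃ W' X', G.SignedPath σ a b W' X' ε ∧ W' ⊆ W ∧ X' ⊆ C := by
  obtain ⟨e, y, X, δ, he, hp, heX, rfl⟩ := h.exists_signedPath σ ha
  rw [hp.isBalancedSet_insert_iff heX] at hC
  obtain ⟨z, W₁, W₂, X₁, X₂, ε₁, ε₂, h₁, h₂, hz, hz', rfl, rfl, rfl⟩ :=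
    hp.split (T := {b}) ⟨b, hb, rfl⟩
  obtain rfl : z = b := (hz.ge rfl).2
  have ha₁ : a ∉ W₁ := fun h => hab (hz'.le ⟨h, h₂.right_mem⟩)
  -- The two arcs have signs `σ e * ε₁` and `ε₂` with product `-1`, so every sign is the sign of one
  -- of them.
  have key : ∀ s x y t : ℤˣ, ¬ s * (x * y) = 1 → t = y ∨ t = s * x := by decide
  rcases key _ _ _ ε hC with rfl | rfl
  · exact ⟨W₂, X₂, h₂.reverse, Set.subset_union_right,
      Set.subset_union_right.trans (Set.subset_insert _ _)⟩
  · exact ⟨_, _, .cons he h₁ ha₁, Set.insert_subset ha Set.subset_union_left,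
      Set.insert_subset_insert Set.subset_union_left⟩

/-! ### Reachability along a set of edges -/

/-- `y` can be reached from `x` along edges in `F`. -/
def Reach (G : Graph α β) (F : Set β) : α → α → Prop :=
  Relation.ReflTransGen fun a b => ∃ e ∈ F, G.IsLink e a b

theorem Reach.symm {F : Set β} {x y : α} (h : G.Reach F x y) : G.Reach F y x := by
  induction h with
  | refl => exact .refl
  | tail _ h ih =>
    obtain ⟨e, he, hl⟩ := h
    exact .head ⟨e, he, hl.symm⟩ ih

theorem Reach.mono {F F' : Set β} (hF : F ⊆ F') {x y : α} (h : G.Reach F x y) :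
    G.Reach F' x y := by
  refine Relation.ReflTransGen.mono ?_ _ _ h
  rintro a b ⟨e, he, hl⟩
  exact ⟨e, hF he, hl⟩

theorem Reach.exists_signedPath (σ : β → ℤˣ) {F : Set β} {x y : α} (h : G.Reach F x y)
    (hx : x ∈ G.vertexSet) : ∃ W X ε, G.SignedPath σ x y W X ε ∧ X ⊆ F := by
  induction h using Relation.ReflTransGen.head_induction_on with
  | refl => exact ⟨_, _, _, .nil hx, by simp⟩
  | @head a b h _ ih =>
    obtain ⟨e, he, hl⟩ := h
    obtain ⟨W, X, ε, hp, hX⟩ := ih hl.right_mem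
    -- If the walk returns to `a`, the detour is discarded and only the part of the path after `a`
    -- is kept.
    by_cases ha : a ∈ W
    · obtain ⟨z, W₁, W₂, X₁, X₂, ε₁, ε₂, h₁, h₂, hz, hz', rfl, rfl, rfl⟩ :=
        hp.split (T := {a}) ⟨a, ha, rfl⟩
      obtain rfl : z = a := (hz.ge rfl).2
      exact ⟨_, _, _, h₂, Set.subset_union_right.trans hX⟩
    · exact ⟨_, _, _, .cons hl hp ha, Set.insert_subset he hX⟩

theorem SignedPath.reach {F : Set β} {x y : α} {W : Set α} {X : Set β} {ε : ℤˣ}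
    (h : G.SignedPath σ x y W X ε) (hX : X ⊆ F) {z : α} (hz : z ∈ W) : G.Reach F x z := by
  induction h with
  | nil => obtain rfl := hz; exact .refl
  | cons hl h hx ih =>
    rcases hz with rfl | hz
    · exact .refl
    · exact .head ⟨_, hX (Or.inl rfl), hl⟩ (ih (fun e he => hX (Or.inr he)) hz)

end Graph

namespace Graph

variable {α β : Type*} {G : Graph α β} {σ : β → ℤˣ}

theorem SignedPath.isCycle {x y : α} {W : Set α} {X : Set β} {ε : ℤˣ}
    (h : G.SignedPath σ y x W X ε) {e : β} (he : G.IsLink e x y) (heX : e ∉ X) :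
    G.IsCycle (insert e X) :=
  ⟨W, h.isCycleWith he heX⟩

theorem IsCycleWith.left_mem {W : Set α} {C : Set β} (h : G.IsCycleWith W C) {e : β} (he : e ∈ C)
    {a b : α} (hab : G.IsLink e a b) : a ∈ W := by
  obtain ⟨n, v, f, _, _, hl, rfl, rfl⟩ := h
  obtain ⟨i, rfl⟩ := he
  rcases hab.left_eq_or_eq (hl i) with rfl | rfl <;> exact ⟨_, rfl⟩

/-! ### Switching -/

/-- If all cycles inside a finite set of edges are balanced, the signs on this set come from a
sign function on the vertices. -/
theorem exists_switching (F : Set β) (hfin : F.Finite)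
    (hF : ∀ X ⊆ F, G.IsCycle X → IsBalancedSet σ X) :
    ∃ τ : α → ℤˣ, ∀ e ∈ F, ∀ x y, G.IsLink e x y → σ e = τ x * τ y := by
  classical
  induction F, hfin using Set.Finite.induction_on with
  | empty => exact ⟨1, by simp⟩
  | @insert e F heF _ ih =>
    obtain ⟨τ, hτ⟩ := ih fun X hX => hF X (hX.trans (Set.subset_insert _ _))
    -- `F` may contain elements that are not edges of `G`; they impose no condition.
    by_cases hl : ∃ x y, G.IsLink e x y
    swap
    · refine ⟨τ, ?_⟩
      rintro f (rfl | hf) x y hxy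
      · exact absurd ⟨x, y, hxy⟩ hl
      · exact hτ f hf x y hxy
    obtain ⟨x, y, hxy⟩ := hl
    have hsame : ∀ τ' : α → ℤˣ, σ e = τ' x * τ' y → ∀ a b, G.IsLink e a b → σ e = τ' a * τ' b := by
      intro τ' h a b hab
      rcases hab.eq_and_eq_or_eq_and_eq hxy with ⟨rfl, rfl⟩ | ⟨rfl, rfl⟩
      · exact h
      · rw [h, mul_comm]
    -- If `F` already joins the ends of `e`, a cycle closes and its balance forces the right sign on
    -- `e`. Otherwise the signs on one side can still be adjusted freely.
    by_cases hr : G.Reach F y x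
    · obtain ⟨W, X, ε, hp, hX⟩ := hr.exists_signedPath σ hxy.right_mem
      have heX : e ∉ X := fun h => heF (hX h)
      have hb := (hp.isBalancedSet_insert_iff heX).1
        (hF _ (Set.insert_subset_insert hX) (hp.isCycle hxy heX))
      rw [hp.eq_mul fun e he => hτ e (hX he)] at hb
      have key : ∀ s a b : ℤˣ, s * (a * b) = 1 → s = b * a := by decide
      refine ⟨τ, ?_⟩
      rintro f (rfl | hf)
      · exact hsame τ (key _ _ _ hb)
      · exact hτ f hf
    · -- multiply by a constant on the component of `x`
      let c : ℤˣ := σ e * (τ x * τ y)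
      refine ⟨fun a => if G.Reach F x a then c * τ a else τ a, ?_⟩
      rintro f (rfl | hf)
      · refine hsame _ ?_
        have key : ∀ s a b : ℤˣ, s = s * (a * b) * a * b := by decide
        rw [if_pos (show G.Reach F x x from .refl), if_neg fun h => hr h.symm]
        exact key _ _ _
      · intro a b hab
        have hiff : G.Reach F x a ↔ G.Reach F x b :=
          ⟨fun h => .tail h ⟨f, hf, hab⟩, fun h => .tail h ⟨f, hf, hab.symm⟩⟩
        rw [hτ f hf a b hab]
        simp only [hiff]
        split_ifs
        · have key : ∀ a b c : ℤˣ, a * b = c * a * (c * b) := by decide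
          exact key _ _ _
        · rfl

/-! ### Balanced cycles and bowties -/

/-- Two vertex-disjoint unbalanced cycles in the same component are part of a bowtie. -/
theorem exists_isBowtie_of_disjoint {S : Set β} {W₁ W₂ : Set α} {C₁ C₂ : Set β}
    (h₁ : G.IsCycleWith W₁ C₁) (hb₁ : ¬ IsBalancedSet σ C₁) (hS₁ : C₁ ⊆ S)
    (h₂ : G.IsCycleWith W₂ C₂) (hb₂ : ¬ IsBalancedSet σ C₂) (hS₂ : C₂ ⊆ S)
    (hW : Disjoint W₁ W₂) {x y : α} (hx : x ∈ W₁) (hy : y ∈ W₂) (hxV : x ∈ G.vertexSet)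
    (hxy : G.Reach S x y) : ∃ X ⊆ S, G.IsBowtie σ X := by
  obtain ⟨W, X, ε, hp, hX⟩ := hxy.exists_signedPath σ hxV
  -- Cutting at the first vertex in `W₂`, and then going back from it to the first vertex in `W₁`,
  -- leaves a path that meets each cycle only in an end.
  obtain ⟨b, V₁, V₂, X₁, X₂, _, _, hp₁, _, hV, _, _, rfl, _⟩ :=
    hp.split (T := W₂) ⟨y, hp.right_mem, hy⟩
  obtain ⟨a, U₁, U₂, Y₁, Y₂, _, _, hq, _, hU, _, rfl, rfl, _⟩ :=
    hp₁.reverse.split (T := W₁) ⟨x, hp₁.left_mem, hx⟩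
  have hbW : b ∈ W₂ := (hV.ge rfl).2
  refine ⟨C₁ ∪ C₂ ∪ Y₁, Set.union_subset (Set.union_subset hS₁ hS₂)
    ((Set.subset_union_left.trans Set.subset_union_left).trans hX),
    W₁, W₂, C₁, C₂, h₁, hb₁, h₂, hb₂, Or.inr ⟨hW, a, b, U₁, Y₁, hq.reverse.isPathWith, hU, ?_, rfl⟩⟩
  ext v
  constructor
  · exact fun hv => hV.le ⟨Or.inl hv.1, hv.2⟩
  · rintro rfl
    exact ⟨hq.left_mem, hbW⟩

/-- A connected graph with a cycle through `e` and an unbalanced cycle avoiding `e` contains a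
balanced cycle or a bowtie. -/
theorem exists_isSignedCircuit_of_cycles {S : Set β} {W W' : Set α} {X C' : Set β} {ε : ℤˣ}
    {e : β} {u v : α} (he : G.IsLink e u v) (hp : G.SignedPath σ v u W X ε) (heX : e ∉ X)
    (heS : e ∈ S) (hXS : X ⊆ S) (hC' : G.IsCycleWith W' C') (hb' : ¬ IsBalancedSet σ C')
    (heC' : e ∉ C') (hS' : C' ⊆ S) {z : α} (hz : z ∈ W') (huz : G.Reach S u z) :
    ∃ Y ⊆ S, G.IsSignedCircuit σ Y := by
  have hCS : insert e X ⊆ S := Set.insert_subset heS hXS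
  by_cases hb : IsBalancedSet σ (insert e X)
  · exact ⟨_, hCS, Or.inl ⟨hp.isCycle he heX, hb⟩⟩
  by_cases hdis : Disjoint W W'
  · obtain ⟨Y, hY, hYb⟩ := exists_isBowtie_of_disjoint (hp.isCycleWith he heX) hb hCS hC' hb' hS'
      hdis hp.right_mem hz he.left_mem huz
    exact ⟨Y, hY, Or.inr hYb⟩
  rw [Set.not_disjoint_iff_nonempty_inter] at hdis
  -- split the path at its first and its last vertex on the other cycle
  obtain ⟨b, W₁, W₂, X₁, X₂, ε₁, ε₂, h₁, h₂, hT, hI, rfl, rfl, rfl⟩ := hp.split hdis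
  have hb1 : b ∈ W' := (hT.ge rfl).2
  obtain ⟨a, U₁, U₂, Y₁, Y₂, δ₁, δ₂, k₁, k₂, hU, hJ, rfl, rfl, rfl⟩ :=
    h₂.reverse.split (T := W') ⟨b, h₂.left_mem, hb1⟩
  have ha1 : a ∈ W' := (hU.ge rfl).2
  by_cases hab : a = b
  · subst hab
    -- A simple path from `a` to itself is trivial, so the two cycles share only `a` and form a
    -- bowtie.
    have hU₂ : ∀ w ∈ U₂, w = a := by
      intro w hw
      cases k₂ with
      | nil => exact hw
      | cons hl hq hx => exact absurd hq.right_mem hx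
    have hinter : (W₁ ∪ (U₁ ∪ U₂)) ∩ W' = {a} := by
      ext w
      constructor
      · rintro ⟨hw | hw | hw, hw'⟩
        · exact hT.le ⟨hw, hw'⟩
        · exact hU.le ⟨hw, hw'⟩
        · exact hU₂ w hw
      · rintro rfl
        exact ⟨Or.inl h₁.right_mem, ha1⟩
    refine ⟨_, Set.union_subset hCS hS', Or.inr ⟨_, W', _, C', hp.isCycleWith he heX, hb, hC', hb',
      Or.inl ⟨⟨a, hinter⟩, ?_, rfl⟩⟩⟩
    rw [Set.disjoint_left]
    rintro f (rfl | hf) hfC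
    · exact heC' hfC
    · obtain ⟨c, d, hcd⟩ := exists_isLink_of_mem_edgeSet (hp.subset_edgeSet hf)
      obtain ⟨hc, hd, hne⟩ := hp.ends_mem hf hcd
      have hc' : c = a := hinter.le ⟨hc, hC'.left_mem hfC hcd⟩
      have hd' : d = a := hinter.le ⟨hd, hC'.left_mem hfC hcd.symm⟩
      exact hne (hc'.trans hd'.symm)
  -- The unbalanced cycle offers arcs of both signs between `b` and `a`; the one chosen makes the
  -- cycle through `e`, `X₁`, the arc and `Y₁` balanced.
  · obtain ⟨W₃, X₃, h₃, hW₃, hX₃⟩ := hC'.exists_arc hb' hb1 ha1 (Ne.symm hab)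
      (σ e * ε₁ * δ₁)
    have hU₁ : b ∉ U₁ := fun h => hab (hJ.le ⟨h, k₂.right_mem⟩).symm
    have q := (h₁.append h₃ fun w hw => hT.le ⟨hw.1, hW₃ hw.2⟩).append k₁.reverse (by
      rintro w ⟨hw | hw, hw'⟩
      · have : w = b := hI.le ⟨hw, Or.inl hw'⟩
        exact absurd (this ▸ hw') hU₁
      · exact hU.le ⟨hw', hW₃ hw⟩)
    have heq : e ∉ X₁ ∪ X₃ ∪ Y₁ := by
      rintro ((h | h) | h)
      · exact heX (Or.inl h)
      · exact heC' (hX₃ h)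
      · exact heX (Or.inr (Or.inl h))
    refine ⟨_, ?_, Or.inl ⟨q.isCycle he heq, (q.isBalancedSet_insert_iff heq).2 ?_⟩⟩
    · refine Set.insert_subset heS (Set.union_subset (Set.union_subset ?_ (hX₃.trans hS')) ?_)
      · exact Set.subset_union_left.trans hXS
      · exact (Set.subset_union_left.trans Set.subset_union_right).trans hXS
    · have key : ∀ s x y : ℤˣ, s * (x * (s * x * y) * y) = 1 := by decide
      exact key _ _ _

end Graph

/-! ### Row codes and their duals -/

section RowCode

variable {K ι κ : Type*} [Field K]

theorem mem_dualCode_rowCode [Fintype ι] (A : Matrix κ ι K) (w : ι → K) :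
    w ∈ dualCode (rowCode A) ↔ A.mulVec w = 0 := by
  constructor
  · intro h
    funext k
    exact h _ (Submodule.subset_span ⟨k, rfl⟩)
  · intro h c hc
    induction hc using Submodule.span_induction with
    | mem c hc =>
      obtain ⟨k, rfl⟩ := hc
      exact congrFun h k
    | zero => exact zero_dotProduct w
    | add x y _ _ hx hy => rw [add_dotProduct, hx, hy, add_zero]
    | smul a x _ hx => rw [smul_dotProduct, hx, smul_zero]

theorem rowCode_eq_range [Fintype κ] (A : Matrix κ ι K) :
    rowCode A = LinearMap.range A.vecMulLinear := by
  rw [range_vecMulLinear]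
  rfl

/-- The dual code is the kernel of `A.mulVec`, so this is rank-nullity together with the equality of
row and column rank. -/
theorem finrank_dualCode_rowCode [Fintype ι] [Finite κ] (A : Matrix κ ι K) :
    Module.finrank K (rowCode A) + Module.finrank K (dualCode (rowCode A)) = Fintype.card ι := by
  have := Fintype.ofFinite κ
  have h : dualCode (rowCode A) = LinearMap.ker A.mulVecLin := by
    ext w
    rw [mem_dualCode_rowCode, LinearMap.mem_ker, Matrix.mulVecLin_apply]
  have h1 := A.mulVecLin.finrank_range_add_finrank_ker
  rw [Module.finrank_fintype_fun_eq_card] at h1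
  rw [h, ← h1]
  congr 1
  exact (Matrix.rank_eq_finrank_span_row A).symm

end RowCode

/-! ### Signs in the field, columns and potentials -/

namespace Graph

variable {α β K : Type*} [Field K] {G : Graph α β} {σ : β → ℤˣ}

/-- Signs stay distinct outside characteristic 2, which lets identities in `K` detect balance. -/
theorem units_eq_of_cast_eq (h2 : (2 : K) ≠ 0) {a b : ℤˣ} (h : ((a : ℤ) : K) = ((b : ℤ) : K)) :
    a = b := by
  have h1 : (1 : K) ≠ -1 := fun h => h2 (by rw [← one_add_one_eq_two]; nth_rw 2 [h]; simp)
  rcases Int.units_eq_one_or a with rfl | rfl <;> rcases Int.units_eq_one_or b with rfl | rfl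
  · rfl
  · exact absurd (by simpa using h) h1
  · exact absurd (by simpa using h.symm) h1
  · rfl

theorem units_cast_mul_self (a : ℤˣ) : ((a : ℤ) : K) * ((a : ℤ) : K) = 1 := by
  rcases Int.units_eq_one_or a with rfl | rfl <;> simp

theorem units_cast_ne_zero (a : ℤˣ) : ((a : ℤ) : K) ≠ 0 :=
  left_ne_zero_of_mul_eq_one (units_cast_mul_self a)

/-- In characteristic 2 the code does not see the signs. -/
theorem units_cast_eq_one (h2 : (2 : K) = 0) (a : ℤˣ) : ((a : ℤ) : K) = 1 := by
  rcases Int.units_eq_one_or a with rfl | rfl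
  · simp
  · have : (-1 : K) = 1 := by linear_combination -h2
    simpa using this

open Classical in
/-- The unit vector of a vertex. -/
noncomputable def unitVector (K : Type*) [Field K] (G : Graph α β) (a : α) : G.vertexSet → K :=
  fun z => if z.1 = a then 1 else 0

namespace IsIncidenceMatrix

variable {A : Matrix G.vertexSet G.edgeSet K}

/-- Frees the column formula from the chosen order of the ends: exchanging them multiplies the
column by `-σ(e)`, because `σ(e)² = 1`. -/
theorem exists_scalar (hA : G.IsIncidenceMatrix σ A) (e : G.edgeSet) {u v : α}
    (he : G.IsLink e u v) : ∃ c : K, c ≠ 0 ∧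
      A.col e = c • (G.unitVector K u - ((σ e : ℤ) : K) • G.unitVector K v) := by
  classical
  obtain ⟨x, y, hxy, hcol⟩ := hA e
  have hs : ∀ x : G.vertexSet, (Pi.single x 1 : G.vertexSet → K) = G.unitVector K x := by
    intro x
    funext z
    simp [Pi.single_apply, unitVector, Subtype.ext_iff]
  have hcol' : A.col e = G.unitVector K x - ((σ e : ℤ) : K) • G.unitVector K y := by
    rw [← hs, ← hs]
    convert hcol
  rcases he.eq_and_eq_or_eq_and_eq hxy with ⟨rfl, rfl⟩ | ⟨rfl, rfl⟩
  · exact ⟨1, one_ne_zero, by rw [hcol', one_smul]⟩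
  · refine ⟨-((σ e : ℤ) : K), neg_ne_zero.2 (units_cast_ne_zero _), ?_⟩
    rw [hcol', smul_sub, smul_smul, neg_mul, units_cast_mul_self]
    module

theorem vecMul_apply [Fintype G.vertexSet] (hA : G.IsIncidenceMatrix σ A) (e : G.edgeSet)
    {u v : α} (he : G.IsLink e u v) : ∃ c : K, c ≠ 0 ∧ ∀ x : α → K,
      Matrix.vecMul (fun z : G.vertexSet => x z) A e = c * (x u - ((σ e : ℤ) : K) * x v) := by
  classical
  obtain ⟨c, hc, hcol⟩ := hA.exists_scalar e he
  refine ⟨c, hc, fun x => ?_⟩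
  have hsum : ∀ a ∈ G.vertexSet, ∑ z : G.vertexSet, x z * G.unitVector K a z = x a := by
    intro a ha
    rw [Finset.sum_eq_single ⟨a, ha⟩]
    · simp [unitVector]
    · intro b _ hb
      rw [unitVector, if_neg (fun h => hb (Subtype.ext h)), mul_zero]
    · simp
  change ∑ z : G.vertexSet, x z * A.col e z = _
  rw [hcol, ← hsum u he.left_mem, ← hsum v he.right_mem, Finset.mul_sum, ← Finset.sum_sub_distrib,
    Finset.mul_sum]
  refine Finset.sum_congr rfl fun z _ => ?_
  simp only [Pi.smul_apply, Pi.sub_apply, smul_eq_mul]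
  ring

theorem vecMul_apply_eq_zero_iff [Fintype G.vertexSet] (hA : G.IsIncidenceMatrix σ A)
    (e : G.edgeSet) {u v : α} (he : G.IsLink e u v) (x : α → K) :
    Matrix.vecMul (fun z : G.vertexSet => x z) A e = 0 ↔ x u = ((σ e : ℤ) : K) * x v := by
  obtain ⟨c, hc, h⟩ := hA.vecMul_apply e he
  rw [h, mul_eq_zero, sub_eq_zero]
  simp [hc]

/-! ### Circuits are supports of words of the dual code -/

theorem image_support_add {E : Set β} {w w' : E → K} {X X' : Set β}
    (hw : Subtype.val '' Function.support w = X) (hw' : Subtype.val '' Function.support w' = X')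
    (hX : Disjoint X X') {a b : K} (ha : a ≠ 0) (hb : b ≠ 0) :
    Subtype.val '' Function.support (a • w + b • w') = X ∪ X' := by
  subst hw hw'
  rw [← Set.image_union]
  congr 1
  rw [Set.disjoint_image_iff Subtype.val_injective, Set.disjoint_left] at hX
  ext i
  have := @hX i
  simp only [Function.mem_support, not_not, Pi.add_apply, Pi.smul_apply, smul_eq_mul,
    Set.mem_union] at this ⊢
  by_cases h1 : w i = 0
  · simp [h1, hb]
  · simp [h1, this h1, ha]

theorem exists_word_of_isLink [Fintype G.edgeSet] (hA : G.IsIncidenceMatrix σ A) {e : β}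
    {x y : α} (he : G.IsLink e x y) : ∃ w : G.edgeSet → K, Subtype.val '' Function.support w = {e} ∧
      A.mulVec w = G.unitVector K x - ((σ e : ℤ) : K) • G.unitVector K y := by
  classical
  obtain ⟨c, hc, hcol⟩ := hA.exists_scalar ⟨e, he.edge_mem⟩ he
  refine ⟨Pi.single ⟨e, he.edge_mem⟩ c⁻¹, ?_, ?_⟩
  · rw [Pi.support_single_of_ne (inv_ne_zero hc), Set.image_singleton]
  · rw [Matrix.mulVec_single, hcol]
    funext z
    simp only [Pi.smul_apply, smul_eq_mul, MulOpposite.smul_eq_mul_unop, MulOpposite.unop_op]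
    rw [mul_comm, inv_mul_cancel_left₀ hc]

/-- Scaling the rest of the path by `σ e` cancels the unit vector at the second vertex, so the sum
telescopes. -/
theorem exists_word_of_signedPath [Fintype G.edgeSet] (hA : G.IsIncidenceMatrix σ A) {x y : α}
    {W : Set α} {X : Set β} {ε : ℤˣ} (h : G.SignedPath σ x y W X ε) :
    ∃ w : G.edgeSet → K, Subtype.val '' Function.support w = X ∧
      A.mulVec w = G.unitVector K x - ((ε : ℤ) : K) • G.unitVector K y := by
  induction h with
  | nil => exact ⟨0, by simp, by simp⟩
  | @cons x y z e W X ε hl h hx ih =>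
    obtain ⟨w, hw, hAw⟩ := ih
    obtain ⟨w', hw', hAw'⟩ := hA.exists_word_of_isLink hl
    refine ⟨(1 : K) • w' + ((σ e : ℤ) : K) • w, ?_, ?_⟩
    · rw [image_support_add hw' hw (Set.disjoint_singleton_left.2 (h.notMem_of_notMem hl hx))
        one_ne_zero (units_cast_ne_zero _), Set.singleton_union]
    · rw [Matrix.mulVec_add, Matrix.mulVec_smul, Matrix.mulVec_smul, hAw, hAw']
      push_cast
      module

/-- Closing the path returns its end vector to `x`, with the sign `ε` of the cycle as factor. Any
vertex of the cycle can serve as `x`, which is what bowties need. -/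
theorem exists_word_of_isCycleWith [Fintype G.edgeSet] (hA : G.IsIncidenceMatrix σ A)
    {W : Set α} {C : Set β} (h : G.IsCycleWith W C) {x : α} (hx : x ∈ W) :
    ∃ (w : G.edgeSet → K) (ε : ℤˣ), Subtype.val '' Function.support w = C ∧
      (IsBalancedSet σ C ↔ ε = 1) ∧ A.mulVec w = (1 - ((ε : ℤ) : K)) • G.unitVector K x := by
  obtain ⟨e, y, X, ε, he, hp, heX, rfl⟩ := h.exists_signedPath σ hx
  obtain ⟨w, hw, hAw⟩ := hA.exists_word_of_signedPath hp
  obtain ⟨w', hw', hAw'⟩ := hA.exists_word_of_isLink he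
  refine ⟨(1 : K) • w' + ((σ e : ℤ) : K) • w, σ e * ε, ?_, hp.isBalancedSet_insert_iff heX, ?_⟩
  · rw [image_support_add hw' hw (Set.disjoint_singleton_left.2 heX)
      one_ne_zero (units_cast_ne_zero _), Set.singleton_union]
  · rw [Matrix.mulVec_add, Matrix.mulVec_smul, Matrix.mulVec_smul, hAw, hAw']
    push_cast
    module

theorem exists_word_of_not_isBalancedSet [Fintype G.edgeSet] (hA : G.IsIncidenceMatrix σ A)
    {W : Set α} {C : Set β} (h : G.IsCycleWith W C) (hC : ¬ IsBalancedSet σ C) {x : α}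
    (hx : x ∈ W) : ∃ w : G.edgeSet → K, Subtype.val '' Function.support w = C ∧
      A.mulVec w = (2 : K) • G.unitVector K x := by
  obtain ⟨w, ε, hw, hε, hAw⟩ := hA.exists_word_of_isCycleWith h hx
  rw [hε] at hC
  obtain rfl := (Int.units_eq_one_or ε).resolve_left hC
  refine ⟨w, hw, ?_⟩
  rw [hAw]
  congr 1
  push_cast
  ring

theorem exists_word_of_isCycle [Fintype G.edgeSet] (hA : G.IsIncidenceMatrix σ A) {C : Set β}
    (h : G.IsCycle C) (hC : (2 : K) = 0 ∨ IsBalancedSet σ C) :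
    ∃ w : G.edgeSet → K, Subtype.val '' Function.support w = C ∧ A.mulVec w = 0 := by
  obtain ⟨W, h⟩ := h
  obtain ⟨x, hx⟩ := h.nonempty
  obtain ⟨w, ε, hw, hε, hAw⟩ := hA.exists_word_of_isCycleWith h hx
  refine ⟨w, hw, ?_⟩
  have : ((ε : ℤ) : K) = 1 := by
    rcases hC with hC | hC
    · exact units_cast_eq_one hC ε
    · rw [hε.1 hC]
      simp
  rw [hAw, this, sub_self, zero_smul]

theorem exists_word_of_isBowtie [Fintype G.edgeSet] (hA : G.IsIncidenceMatrix σ A)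
    (h2 : (2 : K) ≠ 0) {X : Set β} (h : G.IsBowtie σ X) :
    ∃ w : G.edgeSet → K, Subtype.val '' Function.support w = X ∧ A.mulVec w = 0 := by
  obtain ⟨W₁, W₂, C₁, C₂, h₁, hb₁, h₂, hb₂, ⟨⟨x, hx⟩, hdis, rfl⟩ |
    ⟨hdis, x, y, W, P, hP, hx, hy, rfl⟩⟩ := h
  · obtain ⟨w₁, hw₁, hA₁⟩ := hA.exists_word_of_not_isBalancedSet h₁ hb₁ (hx.ge rfl).1
    obtain ⟨w₂, hw₂, hA₂⟩ := hA.exists_word_of_not_isBalancedSet h₂ hb₂ (hx.ge rfl).2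
    refine ⟨(1 : K) • w₁ + (-1 : K) • w₂,
      image_support_add hw₁ hw₂ hdis one_ne_zero (neg_ne_zero.2 one_ne_zero), ?_⟩
    rw [Matrix.mulVec_add, Matrix.mulVec_smul, Matrix.mulVec_smul, hA₁, hA₂]
    module
  · have hxW := (hx.ge rfl).2
    have hyW := (hy.ge rfl).2
    obtain ⟨w₁, hw₁, hA₁⟩ := hA.exists_word_of_not_isBalancedSet h₁ hb₁ hxW
    obtain ⟨w₂, hw₂, hA₂⟩ := hA.exists_word_of_not_isBalancedSet h₂ hb₂ hyW
    obtain ⟨_, _, _, _, hlx, -⟩ := h₁.exists_signedPath σ hxW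
    obtain ⟨ε, hp⟩ := hP.exists_signedPath σ hlx.left_mem
    obtain ⟨w₃, hw₃, hA₃⟩ := hA.exists_word_of_signedPath hp
    -- A path edge on the cycle would have two distinct ends in the single common vertex.
    have hd : ∀ {W' : Set α} {C' : Set β} {a : α}, G.IsCycleWith W' C' → W ∩ W' = {a} →
        Disjoint C' P := by
      intro W' C' a h' ha
      rw [Set.disjoint_left]
      intro f hf hfP
      obtain ⟨c, d, hcd⟩ := exists_isLink_of_mem_edgeSet (hp.subset_edgeSet hfP)
      obtain ⟨hc, hd, hne⟩ := hp.ends_mem hfP hcd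
      have hc' : c = a := ha.le ⟨hc, h'.left_mem hf hcd⟩
      have hd' : d = a := ha.le ⟨hd, h'.left_mem hf hcd.symm⟩
      exact hne (hc'.trans hd'.symm)
    have hd₁₂ : Disjoint C₁ C₂ := by
      rw [Set.disjoint_left]
      intro f hf hf'
      obtain ⟨n, v, e, _, _, hl, rfl, rfl⟩ := h₁
      obtain ⟨i, rfl⟩ := hf
      exact Set.disjoint_left.1 hdis ⟨i, rfl⟩ (h₂.left_mem hf' (hl i))
    -- The images are `2 e_x`, `2 e_y` and `e_x - ε e_y`, so the coefficients `1`, `-ε`, `-2` give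
    -- zero. As `2 ≠ 0`, the path stays in the support.
    refine ⟨(1 : K) • ((1 : K) • w₁ + (-((ε : ℤ) : K)) • w₂) + (-2 : K) • w₃, ?_, ?_⟩
    · refine image_support_add (image_support_add hw₁ hw₂ hd₁₂ one_ne_zero
        (neg_ne_zero.2 (units_cast_ne_zero _))) hw₃
        (Set.disjoint_union_left.2 ⟨hd h₁ hx, hd h₂ hy⟩) one_ne_zero (neg_ne_zero.2 h2)
    · simp only [Matrix.mulVec_add, Matrix.mulVec_smul, hA₁, hA₂, hA₃]
      module

/-! ### Supports of words of the dual code contain circuits -/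

/-- A word of the dual code is tested against the potentials on all but one edge of its support. -/
theorem potential_apply_eq [Fintype G.vertexSet] [Fintype G.edgeSet]
    (hA : G.IsIncidenceMatrix σ A) {w : G.edgeSet → K} (hw : A.mulVec w = 0) {e : β}
    (he : e ∈ Subtype.val '' Function.support w) {x : α → K}
    (hx : ∀ f ∈ Subtype.val '' Function.support w \ {e}, ∀ a b, G.IsLink f a b →
      x a = ((σ f : ℤ) : K) * x b) {u v : α} (hl : G.IsLink e u v) :
    x u = ((σ e : ℤ) : K) * x v := by
  obtain ⟨e, he, rfl⟩ := he
  have h0 : Matrix.vecMul (fun z : G.vertexSet => x z) A ⬝ᵥ w = 0 := by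
    rw [← Matrix.dotProduct_mulVec, hw, dotProduct_zero]
  -- Terms other than that of `e` vanish: off the support because of `w`, on it because of the
  -- potential.
  rw [dotProduct, Finset.sum_eq_single e] at h0
  · exact (hA.vecMul_apply_eq_zero_iff e hl x).1 ((mul_eq_zero.1 h0).resolve_right he)
  · intro f _ hfe
    by_cases hf : w f = 0
    · rw [hf, mul_zero]
    · obtain ⟨a, b, hab⟩ := exists_isLink_of_mem_edgeSet f.2
      rw [(hA.vecMul_apply_eq_zero_iff f hab x).2 (hx f ⟨⟨f, hf, rfl⟩,
        fun h => hfe (Subtype.ext h)⟩ a b hab), zero_mul]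
  · simp

/-- A potential on a component. -/
theorem exists_potential {F : Set β} (u : α) {τ : α → ℤˣ}
    (hτ : ∀ f ∈ F, ∀ a b, G.IsLink f a b → G.Reach F u a → σ f = τ a * τ b) :
    ∃ x : α → K, (∀ a, G.Reach F u a → x a = ((τ a : ℤ) : K)) ∧ (∀ a, ¬ G.Reach F u a → x a = 0) ∧
      ∀ f ∈ F, ∀ a b, G.IsLink f a b → x a = ((σ f : ℤ) : K) * x b := by
  classical
  refine ⟨fun a => if G.Reach F u a then ((τ a : ℤ) : K) else 0, fun a ha => if_pos ha,
    fun a ha => if_neg ha, fun f hf a b hab => ?_⟩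
  have hiff : G.Reach F u a ↔ G.Reach F u b :=
    ⟨fun h => .tail h ⟨f, hf, hab⟩, fun h => .tail h ⟨f, hf, hab.symm⟩⟩
  by_cases ha : G.Reach F u a
  · simp only [if_pos ha, if_pos (hiff.1 ha)]
    rw [hτ f hf a b hab ha]
    push_cast
    rw [mul_assoc, units_cast_mul_self, mul_one]
  · simp only [if_neg ha, if_neg fun h => ha (hiff.2 h), mul_zero]

/-- Without a cycle, an edge `e` of the support is a bridge of it. A potential that is nonzero on
the side of `u` and zero on the other side then fails at `e` alone, which a dual word excludes. -/
theorem exists_isCycle_subset_support [Fintype G.vertexSet] [Fintype G.edgeSet]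
    (hA : G.IsIncidenceMatrix σ A) {w : G.edgeSet → K} (hw : A.mulVec w = 0) (hw0 : w ≠ 0) :
    ∃ X ⊆ Subtype.val '' Function.support w, G.IsCycle X := by
  by_contra! hcon
  obtain ⟨e, he⟩ := Function.ne_iff.1 hw0
  set S := Subtype.val '' Function.support w with hS
  have heS : e.1 ∈ S := ⟨e, he, rfl⟩
  obtain ⟨u, v, hl⟩ := exists_isLink_of_mem_edgeSet e.2
  by_cases hr : G.Reach (S \ {e.1}) v u
  · obtain ⟨W, X, ε, hp, hX⟩ := hr.exists_signedPath σ hl.right_mem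
    exact hcon _ (Set.insert_subset heS (hX.trans Set.sdiff_subset))
      (hp.isCycle hl fun h => (hX h).2 rfl)
  · obtain ⟨τ, hτ⟩ := exists_switching (G := G) (σ := σ) S (Set.toFinite _)
      fun X hX hXc => absurd hXc (hcon X hX)
    obtain ⟨x, hx1, hx0, hx⟩ := exists_potential (K := K) (F := S \ {e.1}) u
      fun f hf a b hab _ => hτ f hf.1 a b hab
    have := hA.potential_apply_eq hw heS hx hl
    rw [hx1 u .refl, hx0 v fun h => hr h.symm, mul_zero] at this
    exact units_cast_ne_zero _ this

/-- Take an edge `e` of a cycle in the support. If its component after deleting `e` is balanced, a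
potential there must extend to `e`, which makes the cycle balanced. Otherwise that component has an
unbalanced cycle avoiding `e`, and `exists_isSignedCircuit_of_cycles` applies. -/
theorem exists_isSignedCircuit_subset_support [Fintype G.vertexSet] [Fintype G.edgeSet]
    (hA : G.IsIncidenceMatrix σ A) (h2 : (2 : K) ≠ 0) {w : G.edgeSet → K} (hw : A.mulVec w = 0)
    (hw0 : w ≠ 0) : ∃ X ⊆ Subtype.val '' Function.support w, G.IsSignedCircuit σ X := by
  obtain ⟨C, hCS, W, hC⟩ := hA.exists_isCycle_subset_support hw hw0
  set S := Subtype.val '' Function.support w with hS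
  obtain ⟨e, u, v, X, ε, hl, hp, heX, rfl⟩ := hC.exists_isLink_and_signedPath σ
  have heS : e ∈ S := hCS (Or.inl rfl)
  have hXS : X ⊆ S := (Set.subset_insert _ _).trans hCS
  have hXF : X ⊆ S \ {e} := fun f hf => ⟨hXS hf, fun h => heX (h ▸ hf)⟩
  set F := S \ {e} with hF
  have hvu : ∀ a ∈ W, G.Reach F u a := fun a ha => hp.reverse.reach hXF ha
  let F' : Set β := {f ∈ F | ∃ a b, G.IsLink f a b ∧ G.Reach F u a}
  by_cases hbal : ∀ Y ⊆ F', G.IsCycle Y → IsBalancedSet σ Y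
  · obtain ⟨τ, hτ⟩ := exists_switching (G := G) (σ := σ) F' (Set.toFinite (F' : Set β)) hbal
    obtain ⟨x, hx1, hx0, hx⟩ := exists_potential (K := K) (F := F) u
      fun f hf a b hab ha => hτ f ⟨hf, a, b, hab, ha⟩ a b hab
    have h := hA.potential_apply_eq hw heS hx hl
    rw [hx1 u .refl, hx1 v (hvu v hp.left_mem)] at h
    have hε : ε = τ v * τ u := by
      refine hp.eq_mul fun f hf a b hab => hτ f ⟨hXF hf, a, b, hab, ?_⟩ a b hab
      exact hvu a (hp.ends_mem hf hab).1
    refine ⟨_, hCS, Or.inl ⟨⟨W, hC⟩, (hp.isBalancedSet_insert_iff heX).2 ?_⟩⟩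
    have h' : τ u = σ e * τ v := units_eq_of_cast_eq h2 (by push_cast; exact h)
    rw [hε, ← mul_assoc, ← h', Int.units_mul_self]
  · push Not at hbal
    obtain ⟨C', hC', ⟨W', hW'⟩, hb'⟩ := hbal
    obtain ⟨f, c, d, Y, δ, hcd, hq, hfY, rfl⟩ := hW'.exists_isLink_and_signedPath σ
    obtain ⟨-, a, b, hab, ha⟩ := hC' (Or.inl rfl)
    exact exists_isSignedCircuit_of_cycles hl hp heX heS hXS hW' hb'
      (fun h => (hC' h).1.2 rfl) (fun g hg => (hC' hg).1.1)
      (hW'.left_mem (Or.inl rfl) hab) (ha.mono Set.sdiff_subset)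

end IsIncidenceMatrix

end Graph

namespace Graph

variable {α β K : Type*} [Field K] {G : Graph α β} {σ : β → ℤˣ}

/-! ### Components -/

theorem reflTransGen_adj_symm {x y : α} (h : Relation.ReflTransGen G.Adj x y) :
    Relation.ReflTransGen G.Adj y x := by
  induction h with
  | refl => exact .refl
  | tail _ h ih => exact .head h.symm ih

theorem reflTransGen_adj_mem {x y : α} (h : Relation.ReflTransGen G.Adj x y)
    (hx : x ∈ G.vertexSet) : y ∈ G.vertexSet := by
  induction h with
  | refl => exact hx
  | tail _ h _ => exact h.right_mem

theorem finite_components [Finite G.vertexSet] : G.components.Finite := by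
  refine ((Set.toFinite G.vertexSet).image
    fun x => {y | Relation.ReflTransGen G.Adj x y}).subset ?_
  rintro S ⟨x, hx, rfl⟩
  exact ⟨x, hx, rfl⟩

theorem IsConnected.components_eq (hG : G.IsConnected) : G.components = {G.vertexSet} := by
  have h : ∀ x ∈ G.vertexSet, {y | Relation.ReflTransGen G.Adj x y} = G.vertexSet := fun x hx =>
    Set.Subset.antisymm (fun y hy => reflTransGen_adj_mem hy hx) fun y hy => hG.2 x hx y hy
  obtain ⟨x, hx⟩ := hG.1
  ext S
  constructor
  · rintro ⟨y, hy, rfl⟩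
    exact h y hy
  · rintro rfl
    exact ⟨x, hx, (h x hx).symm⟩

theorem one_lt_numComponents_iff [Finite G.vertexSet] : 1 < G.numComponents ↔
    ∃ x ∈ G.vertexSet, ∃ y ∈ G.vertexSet, ¬ Relation.ReflTransGen G.Adj x y := by
  rw [numComponents, Set.one_lt_ncard_iff finite_components]
  constructor
  · rintro ⟨_, _, ⟨x, hx, rfl⟩, ⟨y, hy, rfl⟩, hne⟩
    refine ⟨x, hx, y, hy, fun h => hne ?_⟩
    ext z
    exact ⟨fun hz => (reflTransGen_adj_symm h).trans hz, fun hz => h.trans hz⟩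
  · rintro ⟨x, hx, y, hy, h⟩
    refine ⟨_, _, ⟨x, hx, rfl⟩, ⟨y, hy, rfl⟩, fun heq => h ?_⟩
    exact heq.ge (show Relation.ReflTransGen G.Adj y y from .refl)

theorem reflTransGen_deleteEdges_adj (G : Graph α β) (X : Set β) :
    Relation.ReflTransGen (G.deleteEdges X).Adj = G.Reach Xᶜ := by
  unfold Reach
  congr 1
  ext a b
  simp only [Adj, deleteEdges_isLink, Set.mem_compl_iff]
  exact exists_congr fun _ => and_comm

theorem IsConnected.isEdgeCut_iff [Finite G.vertexSet] (hG : G.IsConnected) {X : Set β} :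
    G.IsEdgeCut X ↔ X ⊆ G.edgeSet ∧
      ∃ x ∈ G.vertexSet, ∃ y ∈ G.vertexSet, ¬ G.Reach Xᶜ x y := by
  have : Finite (G.deleteEdges X).vertexSet := ‹Finite G.vertexSet›
  have h1 : G.numComponents = 1 := by rw [numComponents, hG.components_eq, Set.ncard_singleton]
  rw [IsEdgeCut, h1, one_lt_numComponents_iff, reflTransGen_deleteEdges_adj]
  rfl

/-- A connected unbalanced graph has no balanced component, so a cutset only has to create one. -/
theorem IsConnected.isSignedCutset_iff [Finite G.vertexSet] (hG : G.IsConnected)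
    (hb : ¬ G.IsBalanced σ) {X : Set β} :
    G.IsSignedCutset σ X ↔ X ⊆ G.edgeSet ∧ ∃ x ∈ G.vertexSet,
      ((G.deleteEdges X).induce {y | G.Reach Xᶜ x y}).IsBalanced σ := by
  have : Finite (G.deleteEdges X).vertexSet := ‹Finite G.vertexSet›
  have h0 : G.numBalancedComponents σ = 0 := by
    rw [numBalancedComponents, hG.components_eq]
    convert Set.ncard_empty (Set α)
    ext S
    simp only [Set.mem_singleton_iff, Set.mem_ofPred_eq, Set.mem_empty_iff_false, iff_false]
    rintro ⟨rfl, h⟩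
    rw [induce_vertexSet] at h
    exact hb h
  have hpos : 0 < (G.deleteEdges X).numBalancedComponents σ ↔ ∃ x ∈ G.vertexSet,
      ((G.deleteEdges X).induce {y | G.Reach Xᶜ x y}).IsBalanced σ := by
    rw [numBalancedComponents, Set.ncard_pos (finite_components.subset fun S hS => hS.1),
      ← reflTransGen_deleteEdges_adj]
    constructor
    · rintro ⟨_, ⟨x, hx, rfl⟩, h⟩
      exact ⟨x, hx, h⟩
    · rintro ⟨x, hx, h⟩
      exact ⟨_, ⟨x, hx, rfl⟩, h⟩
  rw [IsSignedCutset, h0, hpos]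
  simp [hb]

theorem IsBalanced.isSignedCutset_iff (hb : G.IsBalanced σ) {X : Set β} :
    G.IsSignedCutset σ X ↔ G.IsEdgeCut X := by
  simp [IsSignedCutset, IsEdgeCut, hb]

/-! ### Potentials -/

/-- A potential that vanishes nowhere forces balance. -/
theorem isBalanced_of_potential (h2 : (2 : K) ≠ 0) {x : α → K} (h0 : ∀ a ∈ G.vertexSet, x a ≠ 0)
    (hx : ∀ e a b, G.IsLink e a b → x a = ((σ e : ℤ) : K) * x b) : G.IsBalanced σ := by
  rintro X ⟨W, hW⟩
  obtain ⟨e, u, v, Y, ε, hl, hp, heY, rfl⟩ := hW.exists_isLink_and_signedPath σ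
  rw [hp.isBalancedSet_insert_iff heY]
  have h := hx e u v hl
  rw [hp.apply_eq fun f _ => hx f, ← mul_assoc] at h
  refine units_eq_of_cast_eq h2 (mul_right_cancel₀ (h0 u hl.left_mem) ?_)
  push_cast
  rw [← h, one_mul]

theorem eq_zero_iff_of_reach {F : Set β} {x : α → K}
    (hx : ∀ e ∈ F, ∀ a b, G.IsLink e a b → x a = ((σ e : ℤ) : K) * x b) {a b : α}
    (h : G.Reach F a b) : x a = 0 ↔ x b = 0 := by
  induction h with
  | refl => rfl
  | tail _ h ih =>
    obtain ⟨e, he, hl⟩ := h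
    rw [ih, hx e he _ _ hl, mul_eq_zero]
    simp [units_cast_ne_zero]

theorem IsConnected.reach (hG : G.IsConnected) {a b : α} (ha : a ∈ G.vertexSet)
    (hb : b ∈ G.vertexSet) : G.Reach Set.univ a b := by
  have := hG.2 a ha b hb
  rw [← deleteEdges_empty (G := G), reflTransGen_deleteEdges_adj, Set.compl_empty] at this
  exact this

/-- If the graph is balanced or the characteristic is two, there is a potential that
vanishes nowhere. -/
theorem exists_global_potential [Finite G.edgeSet] (h : (2 : K) = 0 ∨ G.IsBalanced σ) :
    ∃ t : α → K, (∀ a, t a ≠ 0) ∧ ∀ e a b, G.IsLink e a b → t a = ((σ e : ℤ) : K) * t b := by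
  rcases h with h | h
  · exact ⟨fun _ => 1, fun _ => one_ne_zero, fun e _ _ _ => by rw [units_cast_eq_one h, one_mul]⟩
  · obtain ⟨τ, hτ⟩ := exists_switching G.edgeSet (Set.toFinite _) fun X _ hX => h X hX
    refine ⟨fun a => ((τ a : ℤ) : K), fun a => units_cast_ne_zero _, fun e a b hab => ?_⟩
    rw [hτ e hab.edge_mem a b hab]
    push_cast
    rw [mul_assoc, units_cast_mul_self, mul_one]

namespace IsIncidenceMatrix

variable {A : Matrix G.vertexSet G.edgeSet K}

theorem mem_rowCode_iff [Fintype G.vertexSet] {w : G.edgeSet → K} :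
    w ∈ rowCode A ↔ ∃ x : α → K, Matrix.vecMul (fun z : G.vertexSet => x z) A = w := by
  classical
  rw [rowCode_eq_range]
  constructor
  · rintro ⟨x, rfl⟩
    refine ⟨fun a => if h : a ∈ G.vertexSet then x ⟨a, h⟩ else 0, ?_⟩
    have : (fun z : G.vertexSet => if h : z.1 ∈ G.vertexSet then x ⟨z, h⟩ else 0) = x := by
      funext z
      simp
    rw [this]
    rfl
  · rintro ⟨x, rfl⟩
    exact ⟨_, rfl⟩

/-- A nonzero word of the row code with support inside `X` amounts to a potential on the complement
of `X` that is not a potential on the whole graph. -/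
theorem exists_mem_rowCode_iff [Fintype G.vertexSet] (hA : G.IsIncidenceMatrix σ A) {X : Set β} :
    (∃ w ∈ rowCode A, w ≠ 0 ∧ Subtype.val '' Function.support w ⊆ X) ↔
      ∃ x : α → K, (∀ e ∈ Xᶜ, ∀ a b, G.IsLink e a b → x a = ((σ e : ℤ) : K) * x b) ∧
        ∃ e a b, G.IsLink e a b ∧ x a ≠ ((σ e : ℤ) : K) * x b := by
  constructor
  · rintro ⟨w, hw, hw0, hX⟩
    obtain ⟨x, rfl⟩ := mem_rowCode_iff.1 hw
    refine ⟨x, fun e he a b hab => ?_, ?_⟩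
    · rw [← hA.vecMul_apply_eq_zero_iff ⟨e, hab.edge_mem⟩ hab]
      by_contra h
      exact he (hX ⟨_, h, rfl⟩)
    · obtain ⟨e, he⟩ := Function.ne_iff.1 hw0
      obtain ⟨a, b, hab⟩ := exists_isLink_of_mem_edgeSet e.2
      exact ⟨e, a, b, hab, fun h => he ((hA.vecMul_apply_eq_zero_iff e hab x).2 h)⟩
  · rintro ⟨x, hx, e, a, b, hab, hne⟩
    refine ⟨_, mem_rowCode_iff.2 ⟨x, rfl⟩, fun h => hne ?_, ?_⟩
    · exact (hA.vecMul_apply_eq_zero_iff ⟨e, hab.edge_mem⟩ hab x).1 (congrFun h _)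
    · rintro _ ⟨f, hf, rfl⟩
      by_contra hfX
      obtain ⟨c, d, hcd⟩ := exists_isLink_of_mem_edgeSet f.2
      exact hf ((hA.vecMul_apply_eq_zero_iff f hcd x).2 (hx f hfX c d hcd))

/-- Where `x` is a potential, `x / t` is constant along edges. It can fail to be constant on `G`
exactly if the complement of `X` is disconnected; `t` cut off outside one component is an example.
-/
theorem isEdgeCut_iff [Fintype G.vertexSet] (hA : G.IsIncidenceMatrix σ A) (hG : G.IsConnected)
    {t : α → K} (ht0 : ∀ a, t a ≠ 0)
    (ht : ∀ e a b, G.IsLink e a b → t a = ((σ e : ℤ) : K) * t b) {X : Set β} :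
    G.IsEdgeCut X ↔ X ⊆ G.edgeSet ∧
      ∃ w ∈ rowCode A, w ≠ 0 ∧ Subtype.val '' Function.support w ⊆ X := by
  classical
  rw [hG.isEdgeCut_iff, hA.exists_mem_rowCode_iff]
  refine and_congr_right fun _ => ⟨?_, ?_⟩
  · rintro ⟨u, hu, v, hv, huv⟩
    refine ⟨fun a => if G.Reach Xᶜ u a then t a else 0, fun e he a b hab => ?_, ?_⟩
    · have hiff : G.Reach Xᶜ u a ↔ G.Reach Xᶜ u b :=
        ⟨fun h => .tail h ⟨e, he, hab⟩, fun h => .tail h ⟨e, he, hab.symm⟩⟩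
      by_cases h : G.Reach Xᶜ u b
      · simp only [if_pos h, if_pos (hiff.2 h), ht e a b hab]
      · simp only [if_neg h, if_neg fun h' => h (hiff.1 h'), mul_zero]
    · by_contra! hcon
      have := eq_zero_iff_of_reach (fun e _ => hcon e) (hG.reach hu hv)
      rw [if_pos (show G.Reach Xᶜ u u from .refl), if_neg huv] at this
      exact ht0 u (this.2 rfl)
  · rintro ⟨x, hx, e, a, b, hab, hne⟩
    refine ⟨a, hab.left_mem, b, hab.right_mem, fun h => hne ?_⟩
    obtain ⟨W, Y, ε, hp, hY⟩ := h.exists_signedPath σ hab.left_mem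
    have h1 := hp.apply_eq fun f hf => hx f (hY hf)
    have h2 := hp.apply_eq fun f _ => ht f
    rw [ht e a b hab] at h2
    rw [h1, mul_right_cancel₀ (ht0 b) h2]

/-- In the unbalanced case, a switching of a balanced component, extended by zero, is a potential
off `X`; it is not global, since a nonzero global potential would balance the connected graph `G`.
Conversely, a potential off `X` that is nonzero at `u` vanishes nowhere on the component of `u`,
which is therefore balanced. -/
theorem isSignedCutset_iff [Fintype G.vertexSet] [Fintype G.edgeSet]
    (hA : G.IsIncidenceMatrix σ A) (hG : G.IsConnected) (h2 : (2 : K) ≠ 0) {X : Set β} :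
    G.IsSignedCutset σ X ↔ X ⊆ G.edgeSet ∧
      ∃ w ∈ rowCode A, w ≠ 0 ∧ Subtype.val '' Function.support w ⊆ X := by
  by_cases hb : G.IsBalanced σ
  · obtain ⟨t, ht0, ht⟩ := exists_global_potential (K := K) (Or.inr hb)
    rw [hb.isSignedCutset_iff, hA.isEdgeCut_iff hG ht0 ht]
  rw [hG.isSignedCutset_iff hb, hA.exists_mem_rowCode_iff]
  refine and_congr_right fun _ => ⟨?_, ?_⟩
  · rintro ⟨u, hu, hbal⟩
    obtain ⟨τ, hτ⟩ := exists_switching (σ := σ)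
      ((G.deleteEdges X).induce {y | G.Reach Xᶜ u y}).edgeSet
      ((Set.toFinite G.edgeSet).subset (by
        rintro e ⟨a, b, hab, -⟩
        exact ((deleteEdges_isLink ..).to_iff.1 hab).1.edge_mem)) fun Y _ hY => hbal Y hY
    obtain ⟨x, hx1, -, hx⟩ := exists_potential (K := K) (F := Xᶜ) (G := G) (σ := σ) u
      (τ := τ) fun f hf a b hab ha => by
        have : ((G.deleteEdges X).induce {y | G.Reach Xᶜ u y}).IsLink f a b :=
          ⟨(deleteEdges_isLink ..).to_iff.2 ⟨hab, hf⟩, ha, .tail ha ⟨f, hf, hab⟩⟩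
        exact hτ f this.edge_mem a b this
    refine ⟨x, hx, ?_⟩
    by_contra! hcon
    refine hb (isBalanced_of_potential h2 (fun a ha h0 => ?_) hcon)
    rw [eq_zero_iff_of_reach (fun e _ => hcon e) (hG.reach ha hu), hx1 u .refl] at h0
    exact units_cast_ne_zero _ h0
  · rintro ⟨x, hx, e, a, b, hab, hne⟩
    have hu : ∃ u ∈ G.vertexSet, x u ≠ 0 := by
      by_contra! h
      exact hne (by rw [h a hab.left_mem, h b hab.right_mem, mul_zero])
    obtain ⟨u, hu, hxu⟩ := hu
    refine ⟨u, hu, isBalanced_of_potential h2 (x := x) ?_ ?_⟩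
    · intro c hc h0
      exact hxu ((eq_zero_iff_of_reach hx hc).2 h0)
    · rintro f c d ⟨hcd, -, -⟩
      have := (deleteEdges_isLink ..).to_iff.1 hcd
      exact hx f this.2 c d this.1

/-! ### Dimensions -/

theorem finrank_rowCode_add [Fintype G.vertexSet] :
    Module.finrank K (rowCode A) + Module.finrank K (LinearMap.ker A.vecMulLinear) =
      Fintype.card G.vertexSet := by
  rw [rowCode_eq_range, LinearMap.finrank_range_add_finrank_ker, Module.finrank_fintype_fun_eq_card]

theorem exists_potential_of_mem_ker [Fintype G.vertexSet] (hA : G.IsIncidenceMatrix σ A)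
    {x : G.vertexSet → K} (hx : x ∈ LinearMap.ker A.vecMulLinear) :
    ∃ y : α → K, (∀ z : G.vertexSet, y z = x z) ∧
      ∀ e a b, G.IsLink e a b → y a = ((σ e : ℤ) : K) * y b := by
  classical
  let y : α → K := fun a => if h : a ∈ G.vertexSet then x ⟨a, h⟩ else 0
  have hy : (fun z : G.vertexSet => y z) = x := by
    funext z
    simp [y]
  refine ⟨y, congrFun hy, fun e a b hab => ?_⟩
  rw [← hA.vecMul_apply_eq_zero_iff ⟨e, hab.edge_mem⟩ hab, hy]
  exact congrFun hx _

/-- The left kernel consists of the global potentials. On a connected graph a potential that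
vanishes at one vertex vanishes everywhere, so evaluation there is injective. -/
theorem finrank_ker_le_one [Fintype G.vertexSet] (hA : G.IsIncidenceMatrix σ A)
    (hG : G.IsConnected) : Module.finrank K (LinearMap.ker A.vecMulLinear) ≤ 1 := by
  obtain ⟨u, hu⟩ := hG.1
  let f : LinearMap.ker A.vecMulLinear →ₗ[K] K :=
    (LinearMap.proj ⟨u, hu⟩).comp (LinearMap.ker A.vecMulLinear).subtype
  have hf : Function.Injective f := by
    rw [← LinearMap.ker_eq_bot, LinearMap.ker_eq_bot']
    rintro ⟨x, hx⟩ h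
    obtain ⟨y, hy, hpot⟩ := hA.exists_potential_of_mem_ker hx
    have h0 : y u = 0 := (hy ⟨u, hu⟩).trans h
    ext z
    refine (hy z).symm.trans ?_
    exact (eq_zero_iff_of_reach (fun e _ => hpot e) (hG.reach hu z.2)).1 h0
  simpa using LinearMap.finrank_le_finrank_of_injective hf

theorem one_le_finrank_ker [Fintype G.vertexSet] (hA : G.IsIncidenceMatrix σ A)
    (hG : G.IsConnected) {t : α → K} (ht0 : ∀ a, t a ≠ 0)
    (ht : ∀ e a b, G.IsLink e a b → t a = ((σ e : ℤ) : K) * t b) :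
    1 ≤ Module.finrank K (LinearMap.ker A.vecMulLinear) := by
  obtain ⟨u, hu⟩ := hG.1
  rw [Nat.one_le_iff_ne_zero, Ne, Submodule.finrank_eq_zero, Submodule.eq_bot_iff]
  intro h
  refine ht0 u (congrFun (h (fun z => t z) ?_) ⟨u, hu⟩)
  rw [LinearMap.mem_ker, Matrix.vecMulLinear_apply]
  funext e
  obtain ⟨a, b, hab⟩ := exists_isLink_of_mem_edgeSet e.2
  exact (hA.vecMul_apply_eq_zero_iff e hab t).2 (ht e a b hab)

theorem finrank_ker_eq_zero [Fintype G.vertexSet] (hA : G.IsIncidenceMatrix σ A)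
    (hG : G.IsConnected) (h2 : (2 : K) ≠ 0) (hb : ¬ G.IsBalanced σ) :
    Module.finrank K (LinearMap.ker A.vecMulLinear) = 0 := by
  rw [Submodule.finrank_eq_zero, Submodule.eq_bot_iff]
  intro x hx
  obtain ⟨y, hy, hpot⟩ := hA.exists_potential_of_mem_ker hx
  funext z
  rw [← hy z]
  by_contra hz
  refine hb (isBalanced_of_potential h2 (fun a ha h0 => hz ?_) hpot)
  exact (eq_zero_iff_of_reach (fun e _ => hpot e) (hG.reach ha z.2)).1 h0

end IsIncidenceMatrix

/-! ### Minimal sets containing supports -/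

/-- Minimal edge sets containing the support of a nonzero word determine the generalized Hamming
weights. -/
theorem exists_isGenHammingWeight_of_minimal [Finite G.edgeSet] (C : Submodule K (G.edgeSet → K))
    {Q : Set β → Prop} (hQ : ∀ X, Q X ↔ X ⊆ G.edgeSet ∧
      ∃ w ∈ C, w ≠ 0 ∧ Subtype.val '' Function.support w ⊆ X)
    (r : ℕ) (hr : r ≤ Module.finrank K C) :
    ∃ d, IsGenHammingWeight C r d ∧ IsLeast (nonRedundantUnionSizes (Minimal Q) r) d := by
  have hsupp : ∀ w ∈ C, w ≠ 0 → Q (Subtype.val '' Function.support w) := fun w hw hw0 =>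
    (hQ _).2 ⟨by rintro _ ⟨e, -, rfl⟩; exact e.2, w, hw, hw0, subset_rfl⟩
  refine exists_isGenHammingWeight_and_isLeast C _ (fun X hX => ?_) (fun w hw hw0 => ?_) r hr
  · obtain ⟨-, w, hw, hw0, hwX⟩ := (hQ X).1 hX.1
    -- The support inside a minimal `X` satisfies `Q` itself, hence equals `X`.
    exact ⟨w, hw, hw0, hwX.antisymm (hX.2 (hsupp w hw hw0) hwX)⟩
  · have hfin : {X | X ⊆ G.edgeSet}.Finite := (Set.toFinite G.edgeSet).finite_subsets
    obtain ⟨X, hX, hmin⟩ := (hfin.subset fun X (hX : Q X) => ((hQ X).1 hX).1).exists_le_minimal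
      (hsupp w hw hw0)
    exact ⟨X, hmin, hX⟩

end Graph

/-! ### Assembly of the theorem: supports and dimensions -/

theorem mainTheorem2 {α β K : Type*} [Field K] [Finite K] (p : ℕ) [CharP K p]
    (G : Graph α β) [Fintype G.vertexSet] [Fintype G.edgeSet] (σ : β → ℤˣ)
    (hG : G.IsConnected) (s m : ℕ)
    (hs : Fintype.card G.vertexSet = s) (hm : Fintype.card G.edgeSet = m)
    (A : Matrix G.vertexSet G.edgeSet K) (hA : G.IsIncidenceMatrix σ A)
    (C : Submodule K (G.edgeSet → K)) (hC : C = rowCode A) :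
    -- (a)
    ((p = 2 ∨ G.IsBalanced σ) →
      (∀ r : ℕ, 1 ≤ r → (r : ℤ) ≤ (m : ℤ) - s + 1 →
        ∃ d, IsGenHammingWeight (dualCode C) r d ∧
          IsLeast (nonRedundantUnionSizes G.IsCycle r) d) ∧
      (∀ r : ℕ, 1 ≤ r → (r : ℤ) ≤ (s : ℤ) - 1 →
        ∃ d, IsGenHammingWeight C r d ∧
          IsLeast (nonRedundantUnionSizes G.IsCocycle r) d)) ∧
    -- (b)
    (p ≠ 2 →
      (∀ r : ℕ, 1 ≤ r → (r : ℤ) ≤ (m : ℤ) - s →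
        ∃ d, IsGenHammingWeight (dualCode C) r d ∧
          IsLeast (nonRedundantUnionSizes (G.IsSignedCircuit σ) r) d) ∧
      (∀ r : ℕ, 1 ≤ r → r ≤ s → ¬ (G.IsBalanced σ ∧ r = s) →
        ∃ d, IsGenHammingWeight C r d ∧
          IsLeast (nonRedundantUnionSizes (G.IsSignedCocircuit σ) r) d)) := by

  subst hC
  have h2p : p = 2 ↔ (2 : K) = 0 := by
    constructor
    · rintro rfl
      exact CharTwo.two_eq_zero
    · intro h
      have hdvd : p ∣ 2 := (CharP.cast_eq_zero_iff K p 2).1 (by exact_mod_cast h)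
      exact ((Nat.dvd_prime Nat.prime_two).1 hdvd).resolve_left (CharP.char_ne_one K p)
  have hne : ∀ {X : Set β} {w : G.edgeSet → K}, X.Nonempty →
      Subtype.val '' Function.support w = X → w ≠ 0 := by
    rintro X w hX hw rfl
    simp only [Function.support_zero, Set.image_empty] at hw
    exact hX.ne_empty hw.symm
  have hcyc : ∀ {W : Set α} {X : Set β}, G.IsCycleWith W X → X.Nonempty := by
    rintro W X ⟨n, v, e, -, -, -, -, rfl⟩
    exact ⟨e 0, 0, rfl⟩
  have hdim := finrank_dualCode_rowCode A
  have hdim' := Graph.IsIncidenceMatrix.finrank_rowCode_add (A := A)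
  have hker := hA.finrank_ker_le_one hG
  rw [hm] at hdim
  rw [hs] at hdim'
  refine ⟨fun h => ?_, fun h => ?_⟩
  · rw [h2p] at h
    obtain ⟨t, ht0, ht⟩ := Graph.exists_global_potential (K := K) h
    have hker' := hA.one_le_finrank_ker hG ht0 ht
    -- The left kernel has dimension exactly 1, so the code has dimension `s - 1` and its dual `m -
    -- s + 1`.
    refine ⟨fun r _ hr => ?_, fun r _ hr => ?_⟩
    · refine exists_isGenHammingWeight_and_isLeast _ _ (fun X hX => ?_) (fun w hw hw0 => ?_) r
        (by omega)
      · obtain ⟨w, hw, hAw⟩ := hA.exists_word_of_isCycle hX (h.imp_right fun hb => hb X hX)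
        exact ⟨w, (mem_dualCode_rowCode A w).2 hAw, hne (hcyc hX.choose_spec) hw, hw⟩
      · obtain ⟨X, hX, hXc⟩ :=
          hA.exists_isCycle_subset_support ((mem_dualCode_rowCode A w).1 hw) hw0
        exact ⟨X, hXc, hX⟩
    · exact Graph.exists_isGenHammingWeight_of_minimal _
        (fun X => hA.isEdgeCut_iff hG ht0 ht) r (by omega)
  · rw [Ne, h2p] at h
    refine ⟨fun r _ hr => ?_, fun r _ hr hrs => ?_⟩
    -- The code has dimension at most `s`, balanced or not, so its dual has dimension at least `m -
    -- s`.
    · refine exists_isGenHammingWeight_and_isLeast _ _ (fun X hX => ?_) (fun w hw hw0 => ?_) r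
        (by omega)
      · rcases hX with hX | hX
        · obtain ⟨w, hw, hAw⟩ := hA.exists_word_of_isCycle hX.1 (Or.inr hX.2)
          exact ⟨w, (mem_dualCode_rowCode A w).2 hAw, hne (hcyc hX.1.choose_spec) hw, hw⟩
        · obtain ⟨w, hw, hAw⟩ := hA.exists_word_of_isBowtie h hX
          refine ⟨w, (mem_dualCode_rowCode A w).2 hAw, hne ?_ hw, hw⟩
          obtain ⟨W₁, W₂, C₁, C₂, h₁, -, -, -, ⟨-, -, rfl⟩ | ⟨-, x, y, W, P, -, -, -, rfl⟩⟩ := hX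
          · exact (hcyc h₁).mono Set.subset_union_left
          · exact (hcyc h₁).mono (Set.subset_union_left.trans Set.subset_union_left)
      · obtain ⟨X, hX, hXc⟩ :=
          hA.exists_isSignedCircuit_subset_support h ((mem_dualCode_rowCode A w).1 hw) hw0
        exact ⟨X, hXc, hX⟩
    · refine Graph.exists_isGenHammingWeight_of_minimal _
        (fun X => hA.isSignedCutset_iff hG h) r ?_
      -- The dimension is at least `s - 1` in the balanced case and equals `s` in the unbalanced
      -- case.
      by_cases hb : G.IsBalanced σ
      · have : r ≠ s := fun h => hrs ⟨hb, h⟩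
        omega
      · have := hA.finrank_ker_eq_zero hG h hb
        omega
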